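/- For $\mathbf{f}:\mathbb{R}\to\mathbb{R}^3$ in $L^1_{\mathrm{loc}}$ with $\int_{\mathbb{R}} \frac{|\mathbf{f}(x)|}{1+x^2}\,dx<\infty$ set $$\|\mathbf{f}\|_{\dot H^{1/2}}^2=\frac1{2\pi}\iint_{\mathbb{R}\times\mathbb{R}}\frac{|\mathbf{f}(x)-\mathbf{f}(y)|^2}{|x-y|^2}\,dx\,dy ,$$ let $\dot H^{1/2}(\mathbb{R};\mathbb{R}^3)$ be the space of those $\mathbf{f}$ for which this is finite, and let $\dot H^{1/2}(\mathbb{R};\mathbb{S}^2)$ be the set of $\mathbf{Q}\in\dot H^{1/2}(\mathbb{R};\mathbb{R}^3)$ with $|\mathbf{Q}(x)|=1$ for a.e. $x\in\mathbb{R}$. For $\mathbf{f},\mathbf{g}\in\dot H^{1/2}(\mathbb{R};\mathbb{R}^3)$ let $$\langle|\nabla|\mathbf{f},\mathbf{g}\rangle=\frac1{2\pi}\iint_{\mathbb{R}\times\mathbb{R}}\frac{(\mathbf{f}(x)-\mathbf{f}(y))\cdot(\mathbf{g}(x)-\mathbf{g}(y))}{|x-y|^2}\,dx\,dy .$$ For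 $v\in\mathbb{R}$, a map $\mathbf{Q}\in\dot H^{1/2}(\mathbb{R};\mathbb{S}^2)$ is a (weak) solution of the profile equation $$\mathbf{Q}\wedge|\nabla|\mathbf{Q}-v\,\partial_x\mathbf{Q}=0 \qquad (\ast)$$ if $\langle|\nabla|\mathbf{Q},\boldsymbol\varphi\wedge\mathbf{Q}\rangle+v\int_{\mathbb{R}}\mathbf{Q}\cdot\boldsymbol\varphi'\,dx=0$ for all $\boldsymbol\varphi\in C_c^\infty(\mathbb{R};\mathbb{R}^3)$, where $\wedge$ is the cross product in $\mathbb{R}^3$. **Theorem (triviality of traveling solitary waves for $|v|\ge1$).** Let $v\in\mathbb{R}$ with $|v|\ge 1$. Then a map $\mathbf{Q}_v:\mathbb{R}\to\mathbb{R}^3$ belongs to $\dot H^{1/2}(\mathbb{R};\mathbb{S}^2)$ and solves $(\ast)$ if and only if there is a constant $\mathbf{p}\in\mathbb{S}^2$ such that $\mathbf{Q}_v(x)=\mathbf{p}$ for a.e. $x\in\mathbb{R}$. -/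

import Mathlib

open MeasureTheory
open scoped ContDiff Matrix

/-- Euclidean three-space. -/
abbrev E3 : Type := EuclideanSpace ℝ (Fin 3)

/-- The cross product `a ∧ b` on Euclidean three-space. -/
noncomputable def wedge (a b : E3) : E3 := WithLp.toLp 2 (a.ofLp ⨯₃ b.ofLp)

/-- The weighted space `L_{1/2}(ℝ; E)` : locally integrable functions such that
`∫ |f(x)| / (1 + x²) dx` is finite. -/
def MemLHalf {E : Type*} [NormedAddCommGroup E] (f : ℝ → E) : Prop :=
  LocallyIntegrable f volume ∧ Integrable (fun x : ℝ => ‖f x‖ / (1 + x ^ 2)) volume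

/-- The double integral `∬ |f(x) - f(y)|² / |x - y|² dx dy` in `[0, ∞]`, that is, `2π` times the
squared `Ḣ^{1/2}` seminorm. -/
noncomputable def gagliardo {E : Type*} [NormedAddCommGroup E] (f : ℝ → E) : ENNReal :=
  ∫⁻ z : ℝ × ℝ, ENNReal.ofReal (‖f z.1 - f z.2‖ ^ 2 / |z.1 - z.2| ^ 2)

/-- The homogeneous Sobolev space `Ḣ^{1/2}(ℝ; E)`. -/
def MemHdotHalf {E : Type*} [NormedAddCommGroup E] (f : ℝ → E) : Prop :=
  MemLHalf f ∧ gagliardo f < ⊤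

/-- The space `Ḣ^{1/2}(ℝ; S²)` (functions are representatives of their a.e. classes). -/
def MemHdotHalfSphere (u : ℝ → E3) : Prop :=
  MemHdotHalf u ∧ ∀ᵐ x : ℝ, ‖u x‖ = 1

/-- The duality pairing `⟨|∇| f, g⟩` for `f, g ∈ Ḣ^{1/2}(ℝ; ℝ³)`,
`(1 / 2π) ∬ (f(x) - f(y)) · (g(x) - g(y)) / |x - y|² dx dy`; the integral converges absolutely
by the Cauchy–Schwarz inequality. -/
noncomputable def absGradPairing (f g : ℝ → E3) : ℝ :=
  1 / (2 * Real.pi) *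
    ∫ z : ℝ × ℝ, inner ℝ (f z.1 - f z.2) (g z.1 - g z.2) / |z.1 - z.2| ^ 2

/-- The distribution `Q ∧ |∇| Q` applied to a vector-valued test function `φ`. Since
`(Q ∧ w) · φ = w · (φ ∧ Q)`, this is `⟨|∇| Q, φ ∧ Q⟩`, where `φ ∧ Q` is again in `Ḣ^{1/2}` when
`Q ∈ Ḣ^{1/2}` is bounded and `φ` is smooth with compact support. -/
noncomputable def wedgeAbsGrad (Q φ : ℝ → E3) : ℝ :=
  absGradPairing Q (fun x => wedge (φ x) (Q x))

/-- The distributional derivative `∂ₓ Q` applied to a vector-valued test function `φ`. -/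
noncomputable def distribDeriv (Q φ : ℝ → E3) : ℝ :=
  - ∫ x : ℝ, inner ℝ (Q x) (deriv φ x)

/-- `Q` is a weak (distributional) solution of `Q ∧ |∇| Q - v ∂ₓ Q = 0` on `ℝ`. -/
def SolvesProfile (v : ℝ) (Q : ℝ → E3) : Prop :=
  ∀ φ : ℝ → E3, ContDiff ℝ ∞ φ → HasCompactSupport φ →
    wedgeAbsGrad Q φ - v * distribDeriv Q φ = 0

open Filter Topology FourierTransform Convolution SchwartzMap ENNReal

/-! ### Convolution operators on `L²` -/

section ConvolutionL2

variable {H : Type*} [NormedAddCommGroup H] [InnerProductSpace ℂ H] [CompleteSpace H]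

/-! The nontrivial direction tests the equation with the Hilbert transform of `Q`. Write D and W for
the `L²` norms on the plane of (Q(x) - Q(y))/|x - y| and (Q(x) ∧ Q(y))/|x - y|. Triple products with
a repeated vector vanish, so the nonlinear term tested with φ only pairs the difference quotient of
φ with that of Q(x) ∧ Q(y) (`inner_sub_wedge_sub`, `wedgeAbsGrad_eq`). By Cauchy–Schwarz, 2π|v| |∫ Q
· φ'| is at most ‖`diffQuot φ`‖ W. For φ = HQ one has φ' = |∇|Q, so the left side is |v| D², while H
preserves the `Ḣ^{1/2}` seminorm, so the right side is D W. For unit vectors |a ∧ b|² = |a - b|² -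
|a - b|⁴/4 (`norm_wedge_sq`), hence W ≤ D. If |v| ≥ 1, the inequality |v| D² ≤ D W forces D = W, the
quartic deficit has integral zero, and `Q` is constant almost everywhere.

Since HQ is not an admissible test function, two approximations are made. First, H is replaced by
convolution with an odd, smooth, compactly supported kernel whose Fourier transform is bounded by 1
+ 2/r and whose derivative tends to -1/(πh²), with |K'(h)| h² bounded uniformly in r
(`norm_fourier_hilbertKernel_le`, `exists_deriv_hilbertKernel_bound`). Plancherel, applied to each
translation difference of `Q`, gives the seminorm bound (`eLpNorm_diffQuot_kernelConv_le`). Second,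
K ⋆ Q is multiplied by cutoffs at infinity. The errors vanish in the limit because oddness of K and
finite energy put K ⋆ Q in `L²` (`memLp_kernelConv`), although `Q` itself is not in `L²`. -/

theorem SchwartzMap.norm_toL2_sq {H : Type*} [NormedAddCommGroup H] [InnerProductSpace ℂ H]
    (f : 𝓢(ℝ, H)) : ‖f.toLp 2‖ ^ 2 = ∫ x, ‖f x‖ ^ 2 := by
  have h := SchwartzMap.inner_toL2_toL2_eq f f (μ := volume)
  rw [inner_self_eq_norm_sq_to_K] at h
  apply Complex.ofRealLI.injective
  simpa [← LinearIsometry.integral_comp_comm, inner_self_eq_norm_sq_to_K] using h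

/-- Plancherel on both sides: on the Fourier side the convolution is multiplication by `𝓕 K`. -/
theorem SchwartzMap.norm_toL2_convolution_le (K : 𝓢(ℝ, ℂ)) (f : 𝓢(ℝ, H)) {M : ℝ}
    (hM : ∀ ξ, ‖𝓕 K ξ‖ ≤ M) :
    ‖(SchwartzMap.convolution (ContinuousLinearMap.lsmul ℂ ℂ) K f).toLp 2‖
      ≤ M * ‖f.toLp 2‖ := by
  have hM0 : 0 ≤ M := (norm_nonneg _).trans (hM 0)
  rw [← pow_le_pow_iff_left₀ (norm_nonneg _) (mul_nonneg hM0 (norm_nonneg _)) two_ne_zero, mul_pow,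
    SchwartzMap.norm_toL2_sq, SchwartzMap.norm_toL2_sq, ← SchwartzMap.integral_norm_sq_fourier,
    ← SchwartzMap.integral_norm_sq_fourier f, ← integral_const_mul]
  have hInt : ∀ g : 𝓢(ℝ, H), Integrable (fun x => ‖g x‖ ^ 2) := fun g =>
    (memLp_two_iff_integrable_sq_norm g.continuous.aestronglyMeasurable).1 (g.memLp 2)
  refine integral_mono (hInt _) ((hInt (𝓕 f)).const_mul _) fun ξ => ?_
  simp only [SchwartzMap.fourier_convolution, SchwartzMap.pairing_apply_apply,
    ContinuousLinearMap.lsmul_apply, norm_smul, mul_pow]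
  gcongr
  exact hM ξ

theorem eLpNorm_convolution_le_of_contDiff {K : ℝ → ℂ} (hK : ContDiff ℝ ∞ K)
    (hKc : HasCompactSupport K) {M : ℝ} (hM : ∀ ξ, ‖𝓕 K ξ‖ ≤ M) {f : ℝ → H}
    (hf : ContDiff ℝ ∞ f) (hfc : HasCompactSupport f) :
    eLpNorm (K ⋆[ContinuousLinearMap.lsmul ℂ ℂ] f) 2 ≤ ENNReal.ofReal M * eLpNorm f 2 := by
  have h := SchwartzMap.norm_toL2_convolution_le (hKc.toSchwartzMap hK) (hfc.toSchwartzMap hf)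
    (M := M) (fun ξ => by rw [SchwartzMap.fourier_coe]; exact hM ξ)
  rw [SchwartzMap.norm_toLp, SchwartzMap.norm_toLp] at h
  have hM0 : 0 ≤ M := (norm_nonneg _).trans (hM 0)
  have e : (fun x => SchwartzMap.convolution (ContinuousLinearMap.lsmul ℂ ℂ)
      (hKc.toSchwartzMap hK) (hfc.toSchwartzMap hf) x) = K ⋆[ContinuousLinearMap.lsmul ℂ ℂ] f := by
    ext x
    rw [SchwartzMap.convolution_apply]
    rfl
  rw [← e]
  have h1 := SchwartzMap.eLpNorm_lt_top (SchwartzMap.convolution (ContinuousLinearMap.lsmul ℂ ℂ)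
      (hKc.toSchwartzMap hK) (hfc.toSchwartzMap hf)) 2 (μ := volume)
  have h2 := SchwartzMap.eLpNorm_lt_top (hfc.toSchwartzMap hf) 2 (μ := volume)
  rw [← ENNReal.ofReal_le_ofReal_iff (by positivity), ENNReal.ofReal_mul hM0,
    ENNReal.ofReal_toReal h1.ne, ENNReal.ofReal_toReal h2.ne] at h
  exact h

/-- Cauchy–Schwarz in the convolution integral. It turns `L²` approximation of `f` into pointwise
convergence of the convolutions. -/
theorem edist_convolution_le {H : Type*} [NormedAddCommGroup H] [InnerProductSpace ℂ H] {K : ℝ → ℂ} {f g : ℝ → H} (hK : MemLp K 2) (hf : MemLp f 2)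
    (hg : MemLp g 2) (x : ℝ) :
    edist ((K ⋆[ContinuousLinearMap.lsmul ℂ ℂ] g) x) ((K ⋆[ContinuousLinearMap.lsmul ℂ ℂ] f) x) ≤
      eLpNorm K 2 * eLpNorm (f - g) 2 := by
  have hmp : MeasurePreserving (fun t : ℝ => x - t) volume volume :=
    Measure.measurePreserving_sub_left volume x
  have i1 : ∀ {u : ℝ → H}, MemLp u 2 → Integrable (fun t => K t • u (x - t)) := by
    intro u hu
    exact memLp_one_iff_integrable.1 ((hu.comp_measurePreserving hmp).smul hK)
  rw [convolution_def, convolution_def, edist_comm, edist_eq_enorm_sub]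
  simp only [ContinuousLinearMap.lsmul_apply]
  rw [← integral_sub (i1 hf) (i1 hg)]
  refine (enorm_integral_le_lintegral_enorm _).trans ?_
  rw [← eLpNorm_one_eq_lintegral_enorm]
  have e : (fun t => K t • f (x - t) - K t • g (x - t)) = K • ((f - g) ∘ fun t => x - t) := by
    ext t; simp [smul_sub]
  have hsub : AEStronglyMeasurable (f - g) volume :=
    hf.aestronglyMeasurable.sub hg.aestronglyMeasurable
  rw [e]
  refine (eLpNorm_smul_le_mul_eLpNorm (p := 2) (q := 2) (r := 1)
    (hsub.comp_measurePreserving hmp) hK.aestronglyMeasurable).trans ?_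
  rw [eLpNorm_comp_measurePreserving hsub hmp]

/-- Convolution with `K` acts on `L²` with norm at most `sup ‖𝓕 K‖`. -/
theorem eLpNorm_convolution_le {K : ℝ → ℂ} (hK : ContDiff ℝ ∞ K)
    (hKc : HasCompactSupport K) {M : ℝ} (hM : ∀ ξ, ‖𝓕 K ξ‖ ≤ M) {f : ℝ → H}
    (hf : MemLp f 2) :
    eLpNorm (K ⋆[ContinuousLinearMap.lsmul ℂ ℂ] f) 2 ≤ ENNReal.ofReal M * eLpNorm f 2 := by
  have hKL : MemLp K 2 := hK.continuous.memLp_of_hasCompactSupport hKc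
  choose g hgc hg hgf using fun n : ℕ => hf.exist_eLpNorm_sub_le (by simp) (by simp)
    (show (0 : ℝ) < 1 / ((n : ℝ) + 1) by positivity)
  have hlim : Tendsto (fun n => eLpNorm (f - g n) 2) atTop (𝓝 0) := by
    have h0 : Tendsto (fun n : ℕ => ENNReal.ofReal (1 / ((n : ℝ) + 1))) atTop (𝓝 0) := by
      rw [← ENNReal.ofReal_zero]
      exact (ENNReal.continuous_ofReal.tendsto 0).comp tendsto_one_div_add_atTop_nhds_zero_nat
    exact tendsto_of_tendsto_of_tendsto_of_le_of_le tendsto_const_nhds h0 (fun _ => bot_le) hgf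
  have hgL : ∀ n, MemLp (g n) 2 := fun n =>
    (hg n).continuous.memLp_of_hasCompactSupport (hgc n)
  have hptw : ∀ x, Tendsto (fun n => (K ⋆[ContinuousLinearMap.lsmul ℂ ℂ] g n) x) atTop
      (𝓝 ((K ⋆[ContinuousLinearMap.lsmul ℂ ℂ] f) x)) := by
    intro x
    rw [tendsto_iff_edist_tendsto_0]
    have h0 : Tendsto (fun n => eLpNorm K 2 * eLpNorm (f - g n) 2) atTop
        (𝓝 (eLpNorm K 2 * 0)) := ENNReal.Tendsto.const_mul hlim (Or.inr hKL.eLpNorm_ne_top)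
    rw [mul_zero] at h0
    exact tendsto_of_tendsto_of_tendsto_of_le_of_le tendsto_const_nhds h0 (fun _ => bot_le)
      fun n => edist_convolution_le hKL hf (hgL n) x
  -- Fatou: pointwise convergence suffices to pass the bound to the limit.
  refine (Lp.eLpNorm_lim_le_liminf_eLpNorm (fun n =>
    (HasCompactSupport.continuous_convolution_left _ hKc hK.continuous
      (hg n).continuous.locallyIntegrable).aestronglyMeasurable) _
      (Eventually.of_forall hptw)).trans ?_
  have hle : ∀ n, eLpNorm (K ⋆[ContinuousLinearMap.lsmul ℂ ℂ] g n) 2 ≤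
      ENNReal.ofReal M * (eLpNorm f 2 + eLpNorm (f - g n) 2) := by
    intro n
    refine (eLpNorm_convolution_le_of_contDiff hK hKc hM (hg n) (hgc n)).trans ?_
    gcongr
    refine le_trans (le_of_eq ?_) (eLpNorm_sub_le hf.aestronglyMeasurable
      (hf.aestronglyMeasurable.sub (hgL n).aestronglyMeasurable) (by norm_num))
    congr 1
    ext t
    simp
  have hlim2 : Tendsto (fun n => ENNReal.ofReal M * (eLpNorm f 2 + eLpNorm (f - g n) 2)) atTop
      (𝓝 (ENNReal.ofReal M * (eLpNorm f 2 + 0))) :=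
    ENNReal.Tendsto.const_mul (tendsto_const_nhds.add hlim) (Or.inr ENNReal.ofReal_ne_top)
  rw [add_zero] at hlim2
  rw [← hlim2.liminf_eq]
  exact liminf_le_liminf (Eventually.of_forall hle)

end ConvolutionL2

/-- Complexification of real Euclidean space, as a real linear isometry. -/
noncomputable def complexify (n : ℕ) :
    EuclideanSpace ℝ (Fin n) →ₗᵢ[ℝ] EuclideanSpace ℂ (Fin n) where
  toFun x := WithLp.toLp 2 fun i => (x i : ℂ)
  map_add' x y := by ext i; simp
  map_smul' c x := by ext i; simp
  norm_map' x := by simp [EuclideanSpace.norm_eq]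

/-- Plancherel lives over ℂ; complexification is an isometry and commutes with convolution by a real
kernel. -/
theorem eLpNorm_real_convolution_le {K : ℝ → ℝ} (hK : ContDiff ℝ ∞ K)
    (hKc : HasCompactSupport K) {M : ℝ} (hM : ∀ ξ, ‖𝓕 (fun t => (K t : ℂ)) ξ‖ ≤ M) {n : ℕ}
    {f : ℝ → EuclideanSpace ℝ (Fin n)} (hf : MemLp f 2) :
    eLpNorm (K ⋆[ContinuousLinearMap.lsmul ℝ ℝ] f) 2 ≤ ENNReal.ofReal M * eLpNorm f 2 := by
  have hfc : MemLp (fun x => complexify n (f x)) 2 :=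
    (complexify n).toContinuousLinearMap.comp_memLp' hf
  have h := eLpNorm_convolution_le (K := fun t => (K t : ℂ))
    (Complex.ofRealCLM.contDiff.comp hK)
    (hKc.comp_left (g := ((↑) : ℝ → ℂ)) Complex.ofReal_zero) hM hfc
  have e : ((fun t => (K t : ℂ)) ⋆[ContinuousLinearMap.lsmul ℂ ℂ] fun x => complexify n (f x))
      = fun x => complexify n ((K ⋆[ContinuousLinearMap.lsmul ℝ ℝ] f) x) := by
    ext1 x
    rw [convolution_def, convolution_def]
    refine Eq.trans ?_ ((complexify n).integral_comp_comm
      (φ := fun t => ContinuousLinearMap.lsmul ℝ ℝ (K t) (f (x - t))))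
    refine integral_congr_ae (Eventually.of_forall fun t => ?_)
    simp only [ContinuousLinearMap.lsmul_apply, map_smul]
    exact (RCLike.real_smul_eq_coe_smul (K := ℂ) (K t) _).symm
  rw [e] at h
  have hn : ∀ u : ℝ → EuclideanSpace ℝ (Fin n),
      eLpNorm (fun x => complexify n (u x)) 2 = eLpNorm u 2 := fun u =>
    eLpNorm_congr_norm_ae (Eventually.of_forall fun x => (complexify n).norm_map _)
  rwa [hn, hn] at h

/-! ### Smooth truncations of the Hilbert kernel -/

section HilbertKernel

/-- The truncated conjugate Poisson kernel `π⁻¹ (h / (h² + a²) - h / (h² + b²))`. -/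
noncomputable def conjPoisson (a b h : ℝ) : ℝ :=
  Real.pi⁻¹ * (h / (h ^ 2 + a ^ 2) - h / (h ^ 2 + b ^ 2))

/-- The Fourier symbol of `conjPoisson`. -/
noncomputable def conjPoissonSymbol (a b ξ : ℝ) : ℂ :=
  if 0 < ξ then -Complex.I * (Complex.exp (-(2 * Real.pi * a) * ξ)
      - Complex.exp (-(2 * Real.pi * b) * ξ))
    else Complex.I * (Complex.exp ((2 * Real.pi * a) * ξ) - Complex.exp ((2 * Real.pi * b) * ξ))

/-- Subtracting the second exponential makes the symbol vanish at 0, which removes the jump of -i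
sgn ξ. Continuity is needed for Fourier inversion. -/
theorem continuous_conjPoissonSymbol (a b : ℝ) : Continuous (conjPoissonSymbol a b) := by
  refine Continuous.if (fun x hx => ?_) (by fun_prop) (by fun_prop)
  have hx0 : x = 0 := by simpa [frontier_Ioi] using (show x ∈ frontier (Set.Ioi (0 : ℝ)) from hx)
  simp [hx0]

theorem norm_conjPoissonSymbol_le {a b : ℝ} (ha : 0 < a) (hb : 0 < b) (ξ : ℝ) :
    ‖conjPoissonSymbol a b ξ‖ ≤ 1 := by
  have key : ∀ s t : ℝ, s ≤ 0 → t ≤ 0 → ‖Complex.exp (s : ℂ) - Complex.exp (t : ℂ)‖ ≤ 1 := by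
    intro s t hs ht
    rw [← Complex.ofReal_exp, ← Complex.ofReal_exp, ← Complex.ofReal_sub, Complex.norm_real,
      Real.norm_eq_abs, abs_le]
    have h1 := Real.exp_pos s
    have h2 := Real.exp_pos t
    have h3 := Real.exp_le_one_iff.2 hs
    have h4 := Real.exp_le_one_iff.2 ht
    constructor <;> linarith
  have hpi := Real.pi_pos
  unfold conjPoissonSymbol
  split_ifs with h
  · have := key (-(2 * Real.pi * a) * ξ) (-(2 * Real.pi * b) * ξ)
      (by rw [neg_mul, neg_nonpos]; positivity) (by rw [neg_mul, neg_nonpos]; positivity)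
    simpa using this
  · rw [not_lt] at h
    have := key ((2 * Real.pi * a) * ξ) ((2 * Real.pi * b) * ξ)
      (mul_nonpos_of_nonneg_of_nonpos (by positivity) h)
      (mul_nonpos_of_nonneg_of_nonpos (by positivity) h)
    simpa using this

theorem integrable_conjPoissonSymbol {a b : ℝ} (ha : 0 < a) (hb : 0 < b) :
    Integrable (conjPoissonSymbol a b) := by
  have hpi := Real.pi_pos
  rw [← integrableOn_univ, ← Set.Iic_union_Ioi (a := (0 : ℝ)), integrableOn_union]
  have hi1 : ∀ s : ℝ, 0 < s →
      IntegrableOn (fun ξ : ℝ => Complex.exp (-(2 * Real.pi * s) * ξ)) (Set.Ioi 0) := fun s hs =>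
    integrableOn_exp_mul_complex_Ioi (a := -(2 * Real.pi * s))
      (by simpa using mul_pos (mul_pos two_pos hpi) hs) 0
  have hi2 : ∀ s : ℝ, 0 < s →
      IntegrableOn (fun ξ : ℝ => Complex.exp ((2 * Real.pi * s) * ξ)) (Set.Iic 0) := fun s hs =>
    integrableOn_exp_mul_complex_Iic (a := 2 * Real.pi * s)
      (by simpa using mul_pos (mul_pos two_pos hpi) hs) 0
  constructor
  · refine IntegrableOn.congr_fun (((hi2 a ha).sub (hi2 b hb)).const_mul Complex.I) (fun ξ hξ => ?_)
      measurableSet_Iic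
    simp [conjPoissonSymbol, not_lt.2 (Set.mem_Iic.1 hξ)]
  · refine IntegrableOn.congr_fun (((hi1 a ha).sub (hi1 b hb)).const_mul (-Complex.I)) (fun ξ hξ => ?_)
      measurableSet_Ioi
    simp [conjPoissonSymbol, show (0 : ℝ) < ξ from hξ]

/-- The symbol is a combination of decaying exponentials on each half-line, so the integral is
explicit. -/
theorem fourierInv_conjPoissonSymbol {a b : ℝ} (ha : 0 < a) (hb : 0 < b) :
    𝓕⁻ (conjPoissonSymbol a b) = fun h => (conjPoisson a b h : ℂ) := by
  have hpi := Real.pi_pos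
  ext x
  rw [Real.fourierInv_eq']
  have hInt : Integrable fun ξ : ℝ =>
      Complex.exp ((2 * Real.pi * inner ℝ ξ x : ℝ) * Complex.I) • conjPoissonSymbol a b ξ := by
    refine (integrable_conjPoissonSymbol ha hb).bdd_mul (c := 1) (by fun_prop)
      (Eventually.of_forall fun ξ => ?_)
    rw [Complex.norm_exp_ofReal_mul_I]
  have hr : ∀ s : ℝ, 0 < s → (-(2 * Real.pi * s) + 2 * Real.pi * x * Complex.I : ℂ).re < 0 := by
    intro s hs
    simpa using mul_pos (mul_pos two_pos hpi) hs
  have hl : ∀ s : ℝ, 0 < s → 0 < ((2 * Real.pi * s) + 2 * Real.pi * x * Complex.I : ℂ).re := by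
    intro s hs
    simpa using mul_pos (mul_pos two_pos hpi) hs
  rw [← intervalIntegral.integral_Iic_add_Ioi (b := 0) hInt.integrableOn hInt.integrableOn]
  have e1 : ∫ ξ in Set.Iic (0 : ℝ),
      Complex.exp ((2 * Real.pi * inner ℝ ξ x : ℝ) * Complex.I) • conjPoissonSymbol a b ξ =
      Complex.I * (1 / ((2 * Real.pi * a) + 2 * Real.pi * x * Complex.I) -
        1 / ((2 * Real.pi * b) + 2 * Real.pi * x * Complex.I)) := by
    have h1 := integral_exp_mul_complex_Iic (hl a ha) 0
    have h2 := integral_exp_mul_complex_Iic (hl b hb) 0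
    simp only [Complex.ofReal_zero, mul_zero, Complex.exp_zero] at h1 h2
    rw [← h1, ← h2, ← integral_sub (integrableOn_exp_mul_complex_Iic (hl a ha) 0)
      (integrableOn_exp_mul_complex_Iic (hl b hb) 0), ← integral_const_mul]
    refine setIntegral_congr_fun measurableSet_Iic fun ξ hξ => ?_
    simp only [conjPoissonSymbol, if_neg (not_lt.2 (Set.mem_Iic.1 hξ)), smul_eq_mul, add_mul, Complex.exp_add]
    simp
    ring_nf
  have e2 : ∫ ξ in Set.Ioi (0 : ℝ),
      Complex.exp ((2 * Real.pi * inner ℝ ξ x : ℝ) * Complex.I) • conjPoissonSymbol a b ξ =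
      -Complex.I * (-1 / (-(2 * Real.pi * a) + 2 * Real.pi * x * Complex.I) -
        -1 / (-(2 * Real.pi * b) + 2 * Real.pi * x * Complex.I)) := by
    have h1 := integral_exp_mul_complex_Ioi (hr a ha) 0
    have h2 := integral_exp_mul_complex_Ioi (hr b hb) 0
    simp only [Complex.ofReal_zero, mul_zero, Complex.exp_zero] at h1 h2
    rw [← h1, ← h2, ← integral_sub (integrableOn_exp_mul_complex_Ioi (hr a ha) 0)
      (integrableOn_exp_mul_complex_Ioi (hr b hb) 0), ← integral_const_mul]
    refine setIntegral_congr_fun measurableSet_Ioi fun ξ hξ => ?_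
    simp only [conjPoissonSymbol, if_pos (show (0 : ℝ) < ξ from hξ), smul_eq_mul, add_mul,
      Complex.exp_add]
    simp
    ring_nf
  rw [e1, e2]
  -- For one exponential rate, the two half-lines together give a single conjugate Poisson kernel.
  have main : ∀ s : ℝ, 0 < s →
      Complex.I * (1 / ((2 * Real.pi * s) + 2 * Real.pi * x * Complex.I)) +
      -Complex.I * (-1 / (-(2 * Real.pi * s) + 2 * Real.pi * x * Complex.I)) =
      (Real.pi⁻¹ * (x / (x ^ 2 + s ^ 2)) : ℝ) := by
    intro s hs
    have n1 : (s + x * Complex.I : ℂ) ≠ 0 := fun h => by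
      have := congrArg Complex.re h; simp at this; exact hs.ne' this
    have n2 : (s - x * Complex.I : ℂ) ≠ 0 := fun h => by
      have := congrArg Complex.re h; simp at this; exact hs.ne' this
    have n3 : (x ^ 2 + s ^ 2 : ℂ) = (s + x * Complex.I) * (s - x * Complex.I) := by
      linear_combination ((x : ℂ) ^ 2) * Complex.I_sq
    have npi : (Real.pi : ℂ) ≠ 0 := by exact_mod_cast hpi.ne'
    have f1 : (2 * Real.pi * s + 2 * Real.pi * x * Complex.I : ℂ)
        = 2 * Real.pi * (s + x * Complex.I) := by ring
    have f2 : (-(2 * Real.pi * s) + 2 * Real.pi * x * Complex.I : ℂ)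
        = -(2 * Real.pi * (s - x * Complex.I)) := by ring
    rw [f1, f2]
    push_cast
    have hw : (s + x * Complex.I : ℂ) - (s - x * Complex.I) = 2 * x * Complex.I := by ring
    rw [n3]
    generalize (s + x * Complex.I : ℂ) = w at *
    generalize (s - x * Complex.I : ℂ) = w' at *
    field_simp
    linear_combination (-Complex.I) * hw - 2 * (x : ℂ) * Complex.I_sq
  have ma := main a ha
  have mb := main b hb
  simp only [conjPoisson, mul_sub]
  push_cast at ma mb ⊢
  linear_combination ma - mb

theorem continuous_conjPoisson {a b : ℝ} (ha : 0 < a) (hb : 0 < b) :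
    Continuous (conjPoisson a b) := by
  unfold conjPoisson
  refine continuous_const.mul (Continuous.sub ?_ ?_)
  · exact continuous_id.div (by fun_prop) fun x => by positivity
  · exact continuous_id.div (by fun_prop) fun x => by positivity

theorem contDiff_conjPoisson {a b : ℝ} (ha : 0 < a) (hb : 0 < b) :
    ContDiff ℝ ∞ (conjPoisson a b) := by
  unfold conjPoisson
  refine contDiff_const.mul (ContDiff.sub ?_ ?_)
  · exact contDiff_id.div (by fun_prop) fun x => by positivity
  · exact contDiff_id.div (by fun_prop) fun x => by positivity

theorem conjPoisson_eq {a b : ℝ} (ha : 0 < a) (hb : 0 < b) (h : ℝ) :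
    conjPoisson a b h =
      Real.pi⁻¹ * (h * (b ^ 2 - a ^ 2) / ((h ^ 2 + a ^ 2) * (h ^ 2 + b ^ 2))) := by
  have h1 : h ^ 2 + a ^ 2 ≠ 0 := by positivity
  have h2 : h ^ 2 + b ^ 2 ≠ 0 := by positivity
  unfold conjPoisson
  congr 1
  field_simp
  ring

/-- The two kernels cancel to decay |h|⁻³ at infinity; the crude constant `r ^ 3` only serves
integrability. -/
theorem abs_conjPoisson_le {r : ℝ} (hr : 1 ≤ r) (h : ℝ) :
    |conjPoisson r⁻¹ r h| ≤ r ^ 3 * (1 + h ^ 2)⁻¹ := by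
  have hr0 : 0 < r := by linarith
  have hpi : Real.pi⁻¹ ≤ 1 := inv_le_one_of_one_le₀ (by linarith [Real.pi_gt_three])
  have hri : r⁻¹ ≤ 1 := inv_le_one_of_one_le₀ hr
  have hdiff : 0 ≤ r ^ 2 - r⁻¹ ^ 2 := by
    have : r⁻¹ ^ 2 ≤ r ^ 2 := pow_le_pow_left₀ (by positivity) (hri.trans hr) 2
    linarith
  rw [conjPoisson_eq (by positivity) hr0, abs_mul, abs_div, abs_mul, abs_of_nonneg hdiff,
    abs_of_pos (inv_pos.2 Real.pi_pos),
    abs_of_pos (show 0 < (h ^ 2 + r⁻¹ ^ 2) * (h ^ 2 + r ^ 2) by positivity), mul_div_mul_comm]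
  have b1 : |h| / (h ^ 2 + r⁻¹ ^ 2) ≤ r := by
    rw [div_le_iff₀ (by positivity)]
    have : r * (h ^ 2 + r⁻¹ ^ 2) = r * |h| ^ 2 + r⁻¹ := by
      rw [sq_abs]; field_simp
    rw [this]
    have h3 : r * r⁻¹ = 1 := mul_inv_cancel₀ hr0.ne'
    nlinarith [sq_nonneg (r * |h| - 1), abs_nonneg h, inv_pos.2 hr0]
  have b2 : (r ^ 2 - r⁻¹ ^ 2) / (h ^ 2 + r ^ 2) ≤ r ^ 2 * (1 + h ^ 2)⁻¹ := by
    rw [← div_eq_mul_inv]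
    apply div_le_div₀ (by positivity) _ (by positivity) _
    · have := sq_nonneg r⁻¹; linarith
    · nlinarith
  calc Real.pi⁻¹ * (|h| / (h ^ 2 + r⁻¹ ^ 2) * ((r ^ 2 - r⁻¹ ^ 2) / (h ^ 2 + r ^ 2)))
      ≤ 1 * (r * (r ^ 2 * (1 + h ^ 2)⁻¹)) := by gcongr
    _ = _ := by ring

theorem integrable_conjPoisson {r : ℝ} (hr : 1 ≤ r) : Integrable (conjPoisson r⁻¹ r) := by
  refine (integrable_inv_one_add_sq.const_mul (r ^ 3)).mono'
    (continuous_conjPoisson (by positivity) (by positivity)).aestronglyMeasurable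
    (Eventually.of_forall fun h => ?_)
  exact abs_conjPoisson_le hr h

/-- Fourier inversion applied to the symbol, whose forward transform is the reflected kernel and
hence integrable. -/
theorem fourier_conjPoisson {r : ℝ} (hr : 1 ≤ r) :
    𝓕 (fun h => (conjPoisson r⁻¹ r h : ℂ)) = conjPoissonSymbol r⁻¹ r := by
  have hr0 : 0 < r := by linarith
  have hri : 0 < r⁻¹ := by positivity
  rw [← fourierInv_conjPoissonSymbol hri hr0]
  refine (continuous_conjPoissonSymbol _ _).fourier_fourierInv_eq
    (integrable_conjPoissonSymbol hri hr0) ?_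
  have : 𝓕 (conjPoissonSymbol r⁻¹ r) = fun h => ((conjPoisson r⁻¹ r (-h) : ℝ) : ℂ) := by
    ext h
    have := congrFun (fourierInv_conjPoissonSymbol hri hr0) (-h)
    rw [Real.fourierInv_eq_fourier_neg, neg_neg] at this
    exact this
  rw [this]
  exact (integrable_conjPoisson hr).comp_neg.ofReal

/-- Far out the kernel is at most r²/(π|h|³); the condition |h| ≥ r³ turns r²/|h| into 1/r, and h² ≥
(1 + h²)/2. The small factor controls the tail removed by the cutoff. -/
theorem abs_conjPoisson_le_of_le {r h : ℝ} (hr : 1 ≤ r) (hh : r ^ 3 ≤ |h|) :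
    |conjPoisson r⁻¹ r h| ≤ 2 / (Real.pi * r) * (1 + h ^ 2)⁻¹ := by
  have hr0 : 0 < r := by linarith
  have hpi := Real.pi_pos
  have hri : r⁻¹ ≤ 1 := inv_le_one_of_one_le₀ hr
  have hdiff : 0 ≤ r ^ 2 - r⁻¹ ^ 2 := by
    have : r⁻¹ ^ 2 ≤ r ^ 2 := pow_le_pow_left₀ (by positivity) (hri.trans hr) 2
    linarith
  have hh1 : 1 ≤ |h| := (one_le_pow₀ hr).trans hh
  have hsq : h ^ 2 = |h| ^ 2 := (sq_abs h).symm
  rw [conjPoisson_eq (by positivity) hr0, abs_mul, abs_div, abs_mul, abs_of_nonneg hdiff,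
    abs_of_pos (inv_pos.2 hpi),
    abs_of_pos (show 0 < (h ^ 2 + r⁻¹ ^ 2) * (h ^ 2 + r ^ 2) by positivity), hsq]
  generalize |h| = t at *
  have ht : 0 < t := by linarith
  calc Real.pi⁻¹ * (t * (r ^ 2 - r⁻¹ ^ 2) / ((t ^ 2 + r⁻¹ ^ 2) * (t ^ 2 + r ^ 2)))
      ≤ Real.pi⁻¹ * (t * r ^ 2 / (t ^ 2 * t ^ 2)) := by
        gcongr <;> nlinarith [sq_nonneg r⁻¹, sq_nonneg r]
    _ = Real.pi⁻¹ * (r ^ 2 / (t * t ^ 2)) := by field_simp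
    _ ≤ Real.pi⁻¹ * (r ^ 2 / (r ^ 3 * ((1 + t ^ 2) / 2))) := by
        gcongr
        nlinarith
    _ = _ := by field_simp

end HilbertKernel

/-! ### Derivative bounds and compactly supported truncation of the Hilbert kernel -/

section HilbertKernelTruncation

theorem hasDerivAt_div_sq_add_sq {s : ℝ} (hs : 0 < s) (h : ℝ) :
    HasDerivAt (fun h : ℝ => h / (h ^ 2 + s ^ 2)) ((s ^ 2 - h ^ 2) / (h ^ 2 + s ^ 2) ^ 2) h := by
  have h1 : HasDerivAt (fun h : ℝ => h ^ 2 + s ^ 2) (2 * h) h := by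
    simpa using (hasDerivAt_pow 2 h).add_const (s ^ 2)
  exact ((hasDerivAt_id' h).div h1 (by positivity)).congr_deriv (by ring)

theorem abs_deriv_div_sq_add_sq_le {s : ℝ} (hs : 0 < s) (h : ℝ) :
    |(s ^ 2 - h ^ 2) / (h ^ 2 + s ^ 2) ^ 2| ≤ (h ^ 2 + s ^ 2)⁻¹ := by
  have h2 : 0 < h ^ 2 + s ^ 2 := by positivity
  rw [abs_div, abs_of_pos (pow_pos h2 2), div_le_iff₀ (pow_pos h2 2), sq (h ^ 2 + s ^ 2),
    inv_mul_cancel_left₀ h2.ne', abs_le]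
  constructor <;> nlinarith [sq_nonneg h, sq_nonneg s]

theorem hasDerivAt_conjPoisson {a b : ℝ} (ha : 0 < a) (hb : 0 < b) (h : ℝ) :
    HasDerivAt (conjPoisson a b) (Real.pi⁻¹ * ((a ^ 2 - h ^ 2) / (h ^ 2 + a ^ 2) ^ 2 -
      (b ^ 2 - h ^ 2) / (h ^ 2 + b ^ 2) ^ 2)) h :=
  ((hasDerivAt_div_sq_add_sq ha h).sub (hasDerivAt_div_sq_add_sq hb h)).const_mul _

/-- The bound does not depend on `a` and `b`, so it survives as the truncation is removed and gives
domination by the energy density. -/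
theorem abs_deriv_conjPoisson_mul_sq_le {a b : ℝ} (ha : 0 < a) (hb : 0 < b) (h : ℝ) :
    |deriv (conjPoisson a b) h| * h ^ 2 ≤ 1 := by
  rw [(hasDerivAt_conjPoisson ha hb h).deriv, abs_mul, abs_of_pos (inv_pos.2 Real.pi_pos)]
  have key : ∀ s : ℝ, 0 < s → |(s ^ 2 - h ^ 2) / (h ^ 2 + s ^ 2) ^ 2| * h ^ 2 ≤ 1 := by
    intro s hs
    calc _ ≤ (h ^ 2 + s ^ 2)⁻¹ * h ^ 2 := by gcongr; exact abs_deriv_div_sq_add_sq_le hs h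
      _ ≤ 1 := by
        rw [inv_mul_le_iff₀ (by positivity)]
        nlinarith [sq_nonneg s]
  have hpi : Real.pi⁻¹ ≤ 1 / 2 := by
    rw [← one_div]
    exact one_div_le_one_div_of_le two_pos (by linarith [Real.pi_gt_three])
  have habs := abs_sub ((a ^ 2 - h ^ 2) / (h ^ 2 + a ^ 2) ^ 2) ((b ^ 2 - h ^ 2) / (h ^ 2 + b ^ 2) ^ 2)
  calc _ ≤ 1 / 2 * (|(a ^ 2 - h ^ 2) / (h ^ 2 + a ^ 2) ^ 2| +
        |(b ^ 2 - h ^ 2) / (h ^ 2 + b ^ 2) ^ 2|) * h ^ 2 := by gcongr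
    _ = 1 / 2 * (|(a ^ 2 - h ^ 2) / (h ^ 2 + a ^ 2) ^ 2| * h ^ 2 +
        |(b ^ 2 - h ^ 2) / (h ^ 2 + b ^ 2) ^ 2| * h ^ 2) := by ring
    _ ≤ 1 := by linarith [key a ha, key b hb]

theorem abs_conjPoisson_mul_abs_le {a b : ℝ} (ha : 0 < a) (hb : 0 < b) (h : ℝ) :
    |conjPoisson a b h| * |h| ≤ 1 := by
  have key : ∀ s : ℝ, 0 < s → |h / (h ^ 2 + s ^ 2)| * |h| ≤ 1 := by
    intro s hs
    rw [abs_div, abs_of_pos (show 0 < h ^ 2 + s ^ 2 by positivity), div_mul_eq_mul_div,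
      div_le_one (by positivity), ← sq, sq_abs]
    nlinarith [sq_nonneg s]
  have hpi : Real.pi⁻¹ ≤ 1 / 2 := by
    rw [← one_div]
    exact one_div_le_one_div_of_le two_pos (by linarith [Real.pi_gt_three])
  have habs := abs_sub (h / (h ^ 2 + a ^ 2)) (h / (h ^ 2 + b ^ 2))
  rw [conjPoisson, abs_mul, abs_of_pos (inv_pos.2 Real.pi_pos)]
  calc _ ≤ 1 / 2 * (|h / (h ^ 2 + a ^ 2)| + |h / (h ^ 2 + b ^ 2)|) * |h| := by gcongr
    _ = 1 / 2 * (|h / (h ^ 2 + a ^ 2)| * |h| + |h / (h ^ 2 + b ^ 2)| * |h|) := by ring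
    _ ≤ 1 := by linarith [key a ha, key b hb]

/-- The term of width r⁻¹ tends to the derivative of 1/(πh), and the term of width r vanishes. -/
theorem tendsto_deriv_conjPoisson {h : ℝ} (hh : h ≠ 0) :
    Tendsto (fun r : ℝ => deriv (conjPoisson r⁻¹ r) h) atTop (𝓝 (-(Real.pi * h ^ 2)⁻¹)) := by
  have h1 : Tendsto (fun s : ℝ => (s ^ 2 - h ^ 2) / (h ^ 2 + s ^ 2) ^ 2) (𝓝 0)
      (𝓝 (-(h ^ 2)⁻¹)) := by
    have hc : ContinuousAt (fun s : ℝ => (s ^ 2 - h ^ 2) / (h ^ 2 + s ^ 2) ^ 2) 0 :=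
      ContinuousAt.div (by fun_prop) (by fun_prop) (by positivity)
    have e : ((0 : ℝ) ^ 2 - h ^ 2) / (h ^ 2 + 0 ^ 2) ^ 2 = -(h ^ 2)⁻¹ := by
      field_simp
      ring
    rw [← e]
    exact hc
  have h2 : Tendsto (fun r : ℝ => (r ^ 2 - h ^ 2) / (h ^ 2 + r ^ 2) ^ 2) atTop (𝓝 0) := by
    have hz : Tendsto (fun r : ℝ => (h ^ 2 + r ^ 2)⁻¹) atTop (𝓝 0) :=
      tendsto_inv_atTop_zero.comp (tendsto_atTop_add_const_left _ _
        (tendsto_pow_atTop two_ne_zero))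
    refine squeeze_zero_norm' ?_ hz
    filter_upwards [eventually_gt_atTop 0] with r hr
    exact abs_deriv_div_sq_add_sq_le hr h
  have h3 := ((h1.comp tendsto_inv_atTop_zero).sub h2).const_mul Real.pi⁻¹
  have e : Real.pi⁻¹ * (-(h ^ 2)⁻¹ - 0) = -(Real.pi * h ^ 2)⁻¹ := by
    rw [mul_inv]; ring
  rw [e] at h3
  refine h3.congr' ?_
  filter_upwards [eventually_gt_atTop 0] with r hr
  exact (hasDerivAt_conjPoisson (inv_pos.2 hr) hr h).deriv.symm

/-- A smooth even cutoff function on the line, equal to `1` on `[-1, 1]` and supported in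
`[-2, 2]`. -/
noncomputable def cutoff : ContDiffBump (0 : ℝ) := ⟨1, 2, one_pos, one_lt_two⟩

theorem cutoff_eq_one {x : ℝ} (hx : |x| ≤ 1) : cutoff x = 1 :=
  cutoff.one_of_mem_closedBall (by simpa [cutoff] using hx)

theorem cutoff_eq_zero {x : ℝ} (hx : 2 ≤ |x|) : cutoff x = 0 :=
  cutoff.zero_of_le_dist (by simpa [cutoff] using hx)

/-- The weighted bound is invariant under rescaling of the cutoff, hence uniform over all scales. -/
theorem exists_deriv_cutoff_bound :
    ∃ C : ℝ, 0 ≤ C ∧ (∀ x, |deriv cutoff x| ≤ C) ∧ ∀ x, |deriv cutoff x| * |x| ≤ C := by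
  have hd : Continuous (deriv cutoff) :=
    (cutoff.contDiff (n := 1)).continuous_deriv le_rfl
  obtain ⟨C₁, h1⟩ := hd.bounded_above_of_compact_support cutoff.hasCompactSupport.deriv
  obtain ⟨C₂, h2⟩ := (hd.mul continuous_id).bounded_above_of_compact_support
    (cutoff.hasCompactSupport.deriv.mul_right)
  refine ⟨max C₁ C₂, ((norm_nonneg _).trans (h1 0)).trans (le_max_left _ _),
    fun x => (h1 x).trans (le_max_left _ _), fun x => ?_⟩
  have := (h2 x).trans (le_max_right C₁ C₂)
  simpa using this

/-- The truncated Hilbert kernel at scale `r`. -/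
noncomputable def hilbertKernel (r h : ℝ) : ℝ := cutoff (h / r ^ 3) * conjPoisson r⁻¹ r h

theorem contDiff_hilbertKernel {r : ℝ} (hr : 1 ≤ r) : ContDiff ℝ ∞ (hilbertKernel r) :=
  (cutoff.contDiff.comp (contDiff_id.div_const _)).mul
    (contDiff_conjPoisson (by positivity) (by positivity))

theorem hasCompactSupport_hilbertKernel {r : ℝ} (hr : 1 ≤ r) :
    HasCompactSupport (hilbertKernel r) := by
  refine HasCompactSupport.intro (isCompact_Icc (a := -(2 * r ^ 3)) (b := 2 * r ^ 3))
    fun x hx => ?_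
  have hr3 : 0 < r ^ 3 := by positivity
  rw [Set.mem_Icc, ← abs_le, not_le] at hx
  rw [hilbertKernel, cutoff_eq_zero, zero_mul]
  rw [abs_div, abs_of_pos hr3, le_div_iff₀ hr3]
  exact hx.le

theorem hilbertKernel_neg (r h : ℝ) : hilbertKernel r (-h) = -hilbertKernel r h := by
  rw [hilbertKernel, hilbertKernel, neg_div, cutoff.neg, conjPoisson, conjPoisson]
  simp only [neg_sq]
  ring

/-- The untruncated symbol contributes at most 1. The removed tail lives on |h| ≥ r³, and its `L¹`
norm, at most (2/(πr)) · π = 2/r, bounds its transform. -/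
theorem norm_fourier_hilbertKernel_le {r : ℝ} (hr : 1 ≤ r) (ξ : ℝ) :
    ‖𝓕 (fun h => (hilbertKernel r h : ℂ)) ξ‖ ≤ 1 + 2 / r := by
  have hr0 : 0 < r := by linarith
  have hr3 : 0 < r ^ 3 := by positivity
  have hi1 : Integrable (hilbertKernel r) :=
    (contDiff_hilbertKernel hr).continuous.integrable_of_hasCompactSupport
      (hasCompactSupport_hilbertKernel hr)
  have hi2 := integrable_conjPoisson hr
  have e : (fun h => (hilbertKernel r h : ℂ)) = (fun h => (conjPoisson r⁻¹ r h : ℂ)) +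
      fun h => ((hilbertKernel r h - conjPoisson r⁻¹ r h : ℝ) : ℂ) := by
    ext h; simp
  have hadd : 𝓕 ((fun h => (conjPoisson r⁻¹ r h : ℂ)) +
      fun h => ((hilbertKernel r h - conjPoisson r⁻¹ r h : ℝ) : ℂ)) =
      𝓕 (fun h => (conjPoisson r⁻¹ r h : ℂ)) +
      𝓕 (fun h => ((hilbertKernel r h - conjPoisson r⁻¹ r h : ℝ) : ℂ)) :=
    VectorFourier.fourierIntegral_add Real.continuous_fourierChar continuous_inner
      hi2.ofReal (hi1.sub hi2).ofReal
  rw [e, hadd]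
  refine (norm_add_le _ _).trans (add_le_add ?_ ?_)
  · rw [fourier_conjPoisson hr]
    exact norm_conjPoissonSymbol_le (by positivity) hr0 ξ
  · refine (VectorFourier.norm_fourierIntegral_le_integral_norm _ _ _ _ _).trans ?_
    have hb : ∀ h : ℝ, ‖((hilbertKernel r h - conjPoisson r⁻¹ r h : ℝ) : ℂ)‖ ≤
        2 / (Real.pi * r) * (1 + h ^ 2)⁻¹ := by
      intro h
      rw [Complex.norm_real, Real.norm_eq_abs, hilbertKernel]
      rcases le_total |h| (r ^ 3) with hh | hh
      · rw [cutoff_eq_one (by rw [abs_div, abs_of_pos hr3]; exact div_le_one_of_le₀ hh hr3.le)]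
        simp only [one_mul, sub_self, abs_zero]
        positivity
      · refine le_trans ?_ (abs_conjPoisson_le_of_le hr hh)
        have h0 := cutoff.nonneg (x := h / r ^ 3)
        have h1 := cutoff.le_one (x := h / r ^ 3)
        rw [← sub_one_mul, abs_mul]
        refine mul_le_of_le_one_left (abs_nonneg _) ?_
        rw [abs_le]
        constructor <;> linarith
    refine (integral_mono (hi1.sub hi2).ofReal.norm
      (integrable_inv_one_add_sq.const_mul _) hb).trans (le_of_eq ?_)
    rw [integral_const_mul, integral_univ_inv_one_add_sq]
    field_simp

/-- In the product rule one factor |h| goes to the cutoff derivative and one to the kernel, or both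
to the kernel derivative; each bound is scale invariant. -/
theorem exists_deriv_hilbertKernel_bound :
    ∃ C : ℝ, ∀ r : ℝ, 1 ≤ r → ∀ h, |deriv (hilbertKernel r) h| * h ^ 2 ≤ C := by
  obtain ⟨C, hC0, -, hC⟩ := exists_deriv_cutoff_bound
  refine ⟨C + 1, fun r hr h => ?_⟩
  have hr0 : 0 < r := by linarith
  have hr3 : 0 < r ^ 3 := by positivity
  have hri : 0 < r⁻¹ := by positivity
  have d1 : HasDerivAt (fun h : ℝ => cutoff (h / r ^ 3))
      (deriv cutoff (h / r ^ 3) * (1 / r ^ 3)) h := by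
    have hc : HasDerivAt cutoff (deriv cutoff (h / r ^ 3)) (h / r ^ 3) :=
      ((cutoff.contDiff (n := 1)).differentiable one_ne_zero _).hasDerivAt
    exact HasDerivAt.comp (h₂ := fun y : ℝ => cutoff y) h hc ((hasDerivAt_id h).div_const (r ^ 3))
  have d2 := hasDerivAt_conjPoisson hri hr0 h
  have e : deriv (hilbertKernel r) h = deriv cutoff (h / r ^ 3) * (1 / r ^ 3) *
      conjPoisson r⁻¹ r h + cutoff (h / r ^ 3) * deriv (conjPoisson r⁻¹ r) h := by
    rw [d2.deriv]
    exact (d1.mul d2).deriv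
  have b1 : |deriv cutoff (h / r ^ 3) * (1 / r ^ 3) * conjPoisson r⁻¹ r h| * h ^ 2 ≤ C := by
    have e1 : |deriv cutoff (h / r ^ 3) * (1 / r ^ 3) * conjPoisson r⁻¹ r h| * h ^ 2 =
        (|deriv cutoff (h / r ^ 3)| * |h / r ^ 3|) * (|conjPoisson r⁻¹ r h| * |h|) := by
      rw [abs_mul, abs_mul, abs_div, abs_div, abs_of_pos hr3, abs_one, ← sq_abs h]
      ring
    rw [e1, ← mul_one C]
    exact mul_le_mul (hC _) (abs_conjPoisson_mul_abs_le hri hr0 h) (by positivity) hC0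
  have b2 : |cutoff (h / r ^ 3) * deriv (conjPoisson r⁻¹ r) h| * h ^ 2 ≤ 1 := by
    rw [abs_mul, mul_assoc]
    refine mul_le_one₀ ?_ (by positivity) (abs_deriv_conjPoisson_mul_sq_le hri hr0 h)
    rw [abs_of_nonneg cutoff.nonneg]
    exact cutoff.le_one
  rw [e]
  calc _ ≤ (|deriv cutoff (h / r ^ 3) * (1 / r ^ 3) * conjPoisson r⁻¹ r h| +
        |cutoff (h / r ^ 3) * deriv (conjPoisson r⁻¹ r) h|) * h ^ 2 := by
        gcongr; exact abs_add_le _ _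
    _ ≤ C + 1 := by rw [add_mul]; exact add_le_add b1 b2

theorem tendsto_deriv_hilbertKernel {h : ℝ} (hh : h ≠ 0) :
    Tendsto (fun r : ℝ => deriv (hilbertKernel r) h) atTop (𝓝 (-(Real.pi * h ^ 2)⁻¹)) := by
  refine (tendsto_deriv_conjPoisson hh).congr' ?_
  filter_upwards [(tendsto_pow_atTop (α := ℝ) (three_ne_zero)).eventually_gt_atTop |h|,
    eventually_gt_atTop 0] with r hr hr0
  refine (EventuallyEq.deriv_eq ?_).symm
  filter_upwards [(continuous_abs.tendsto h).eventually_lt_const hr] with x hx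
  have hr3 : 0 < r ^ 3 := by positivity
  rw [hilbertKernel, cutoff_eq_one, one_mul]
  rw [abs_div, abs_of_pos hr3]
  exact div_le_one_of_le₀ hx.le hr3.le

end HilbertKernelTruncation

/-! ### The wedge product of unit vectors -/

section Wedge

/-- Since a · (p ∧ a) and b · (q ∧ b) vanish, only mixed triple products remain, and these are
cyclic. -/
theorem inner_sub_wedge_sub (a b p q : E3) :
    inner ℝ (a - b) (wedge p a - wedge q b) = -inner ℝ (p - q) (wedge a b) := by
  simp [wedge, PiLp.inner_apply, Fin.sum_univ_three, cross_apply]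
  ring

/-- Lagrange's identity gives 1 - (a · b)², with a · b = 1 - |a - b|²/2. The quartic deficit is what
finally forces constancy. -/
theorem norm_wedge_sq {a b : E3} (ha : ‖a‖ = 1) (hb : ‖b‖ = 1) :
    ‖wedge a b‖ ^ 2 = ‖a - b‖ ^ 2 - ‖a - b‖ ^ 4 / 4 := by
  have ha' : ‖a‖ ^ 2 = 1 := by rw [ha, one_pow]
  have hb' : ‖b‖ ^ 2 = 1 := by rw [hb, one_pow]
  rw [show ‖a - b‖ ^ 4 = (‖a - b‖ ^ 2) ^ 2 by ring]
  simp only [EuclideanSpace.real_norm_sq_eq, Fin.sum_univ_three, PiLp.sub_apply, wedge,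
    cross_apply, Matrix.cons_val_zero, Matrix.cons_val_one, Matrix.cons_val] at *
  generalize a.ofLp 0 = a0 at *
  generalize a.ofLp 1 = a1 at *
  generalize a.ofLp 2 = a2 at *
  generalize b.ofLp 0 = b0 at *
  generalize b.ofLp 1 = b1 at *
  generalize b.ofLp 2 = b2 at *
  have hd : (a0 - b0) ^ 2 + (a1 - b1) ^ 2 + (a2 - b2) ^ 2
      = 2 - 2 * (a0 * b0 + a1 * b1 + a2 * b2) := by linear_combination ha' + hb'
  rw [hd]
  linear_combination (b0 ^ 2 + b1 ^ 2 + b2 ^ 2) * ha' + hb'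

theorem continuous_wedge : Continuous fun p : E3 × E3 => wedge p.1 p.2 := by
  unfold wedge
  refine (PiLp.continuous_toLp 2 _).comp ?_
  refine continuous_pi fun i => ?_
  fin_cases i <;> simp [cross_apply] <;> fun_prop

end Wedge

/-! ### Difference quotients -/

section Gagliardo

variable {E : Type*} [NormedAddCommGroup E] [NormedSpace ℝ E]

/-- The difference quotient `(f x - f y) / |x - y|`. -/
noncomputable def diffQuot (f : ℝ → E) (z : ℝ × ℝ) : E := |z.1 - z.2|⁻¹ • (f z.1 - f z.2)

/-- The quotient `(f x ∧ f y) / |x - y|`. -/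
noncomputable def wedgeQuot (f : ℝ → E3) (z : ℝ × ℝ) : E3 :=
  |z.1 - z.2|⁻¹ • wedge (f z.1) (f z.2)

theorem norm_diffQuot_sq (f : ℝ → E) (z : ℝ × ℝ) :
    ‖diffQuot f z‖ ^ 2 = ‖f z.1 - f z.2‖ ^ 2 / |z.1 - z.2| ^ 2 := by
  rw [diffQuot, norm_smul, mul_pow, norm_inv, Real.norm_eq_abs, abs_abs, inv_pow]
  ring

theorem norm_wedgeQuot_sq (f : ℝ → E3) (z : ℝ × ℝ) :
    ‖wedgeQuot f z‖ ^ 2 = ‖wedge (f z.1) (f z.2)‖ ^ 2 / |z.1 - z.2| ^ 2 := by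
  rw [wedgeQuot, norm_smul, mul_pow, norm_inv, Real.norm_eq_abs, abs_abs, inv_pow]
  ring

theorem eLpNorm_two_sq {α F : Type*} [MeasurableSpace α] [NormedAddCommGroup F] (μ : Measure α)
    (f : α → F) : eLpNorm f 2 μ ^ 2 = ∫⁻ x, ‖f x‖ₑ ^ 2 ∂μ := by
  have h := eLpNorm_nnreal_pow_eq_lintegral (μ := μ) (f := f) (p := 2) two_ne_zero
  simpa using h

theorem gagliardo_eq (f : ℝ → E) : gagliardo f = eLpNorm (diffQuot f) 2 ^ 2 := by
  rw [eLpNorm_two_sq, gagliardo]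
  refine lintegral_congr fun z => ?_
  rw [← norm_diffQuot_sq, ← ofReal_norm, ENNReal.ofReal_pow (norm_nonneg _)]

theorem MeasureTheory.StronglyMeasurable.diffQuot {f : ℝ → E} (hf : StronglyMeasurable f) :
    StronglyMeasurable (diffQuot f) := by
  have h1 : StronglyMeasurable fun z : ℝ × ℝ => |z.1 - z.2|⁻¹ :=
    (by fun_prop : Measurable fun z : ℝ × ℝ => |z.1 - z.2|⁻¹).stronglyMeasurable
  exact h1.smul ((hf.comp_measurable measurable_fst).sub (hf.comp_measurable measurable_snd))

theorem MeasureTheory.StronglyMeasurable.wedgeQuot {f : ℝ → E3} (hf : StronglyMeasurable f) :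
    StronglyMeasurable (wedgeQuot f) := by
  have h1 : StronglyMeasurable fun z : ℝ × ℝ => |z.1 - z.2|⁻¹ :=
    (by fun_prop : Measurable fun z : ℝ × ℝ => |z.1 - z.2|⁻¹).stronglyMeasurable
  exact h1.smul (continuous_wedge.comp_stronglyMeasurable
    ((hf.comp_measurable measurable_fst).prodMk (hf.comp_measurable measurable_snd)))

theorem norm_wedgeQuot_le {Q : ℝ → E3} (hQ : ∀ x, ‖Q x‖ = 1) (z : ℝ × ℝ) :
    ‖wedgeQuot Q z‖ ≤ ‖diffQuot Q z‖ := by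
  rw [← pow_le_pow_iff_left₀ (norm_nonneg _) (norm_nonneg _) two_ne_zero, norm_wedgeQuot_sq,
    norm_diffQuot_sq, norm_wedge_sq (hQ _) (hQ _)]
  gcongr
  have : 0 ≤ ‖Q z.1 - Q z.2‖ ^ 4 := by positivity
  linarith

/-- The weak form of `Q ∧ |∇| Q` in terms of `Q(x) ∧ Q(y)`. -/
theorem wedgeAbsGrad_eq (Q φ : ℝ → E3) :
    wedgeAbsGrad Q φ =
      -(1 / (2 * Real.pi) * ∫ z : ℝ × ℝ, inner ℝ (diffQuot φ z) (wedgeQuot Q z)) := by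
  rw [wedgeAbsGrad, absGradPairing, ← mul_neg, ← integral_neg]
  congr 1
  refine integral_congr_ae (Eventually.of_forall fun z => ?_)
  simp only [inner_sub_wedge_sub, diffQuot, wedgeQuot, real_inner_smul_left,
    real_inner_smul_right]
  ring

theorem ofReal_abs_integral_inner_le {α F : Type*} [MeasurableSpace α] [NormedAddCommGroup F]
    [InnerProductSpace ℝ F] {μ : Measure α} {f g : α → F} (hf : AEStronglyMeasurable f μ)
    (hg : AEStronglyMeasurable g μ) :
    ENNReal.ofReal |∫ x, inner ℝ (f x) (g x) ∂μ| ≤ eLpNorm f 2 μ * eLpNorm g 2 μ := by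
  rw [← Real.norm_eq_abs, ofReal_norm]
  refine (enorm_integral_le_lintegral_enorm _).trans ?_
  rw [← eLpNorm_one_eq_lintegral_enorm]
  refine (eLpNorm_le_eLpNorm_mul_eLpNorm_of_nnnorm (p := 2) (q := 2) (r := 1) hf hg
    (fun a b => inner ℝ a b) 1 (Eventually.of_forall fun x => ?_)).trans (by simp)
  rw [one_mul]
  exact nnnorm_inner_le_nnnorm (𝕜 := ℝ) (f x) (g x)

/-- Testing the profile equation and the Cauchy–Schwarz inequality. -/
theorem SolvesProfile.ofReal_abs_integral_le {v : ℝ} {Q : ℝ → E3} (h : SolvesProfile v Q)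
    (hQ : StronglyMeasurable Q) {φ : ℝ → E3} (hφ : ContDiff ℝ ∞ φ) (hφc : HasCompactSupport φ) :
    ENNReal.ofReal (2 * Real.pi * |v| * |∫ x, inner ℝ (Q x) (deriv φ x)|) ≤
      eLpNorm (diffQuot φ) 2 * eLpNorm (wedgeQuot Q) 2 := by
  have hpi := Real.pi_pos
  refine le_trans (le_of_eq ?_) (ofReal_abs_integral_inner_le
    hφ.continuous.stronglyMeasurable.diffQuot.aestronglyMeasurable
    hQ.wedgeQuot.aestronglyMeasurable)
  have h1 := h φ hφ hφc
  rw [wedgeAbsGrad_eq, distribDeriv] at h1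
  have h2 : ∫ z : ℝ × ℝ, inner ℝ (diffQuot φ z) (wedgeQuot Q z) =
      2 * Real.pi * v * ∫ x, inner ℝ (Q x) (deriv φ x) := by
    field_simp at h1
    linarith
  rw [h2, abs_mul, abs_mul, abs_of_pos (by positivity : 0 < 2 * Real.pi)]

theorem lintegral_prod_eq_lintegral_sub {F : ℝ × ℝ → ℝ≥0∞} (hF : Measurable F) :
    ∫⁻ z, F z = ∫⁻ h, ∫⁻ x, F (x, x - h) := by
  rw [Measure.volume_eq_prod, lintegral_prod _ hF.aemeasurable]
  rw [lintegral_lintegral_swap (f := fun h x => F (x, x - h))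
    (hF.comp (by fun_prop : Measurable fun p : ℝ × ℝ => (p.2, p.2 - p.1))).aemeasurable]
  exact lintegral_congr fun x =>
    (lintegral_sub_left_eq_self (μ := volume) (fun y => F (x, y)) x).symm

/-- Slicing along y = x - h expresses the energy through `L²` norms of translation differences, to
which `L²` bounds for convolutions apply. -/
theorem gagliardo_eq_lintegral {f : ℝ → E} (hf : StronglyMeasurable f) :
    gagliardo f = ∫⁻ h, ENNReal.ofReal (|h| ^ 2)⁻¹ * eLpNorm (fun x => f x - f (x - h)) 2 ^ 2 := by
  rw [gagliardo_eq, eLpNorm_two_sq, lintegral_prod_eq_lintegral_sub (hf.diffQuot.enorm.pow_const 2)]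
  refine lintegral_congr fun h => ?_
  rw [eLpNorm_two_sq, ← lintegral_const_mul']
  · refine lintegral_congr fun x => ?_
    rw [diffQuot, enorm_smul, mul_pow]
    congr 1
    rw [← ofReal_norm, ← ENNReal.ofReal_pow (norm_nonneg _), norm_inv, Real.norm_eq_abs, abs_abs,
      inv_pow]
    dsimp only
    rw [_root_.sub_sub_cancel]
  · exact ENNReal.ofReal_ne_top

end Gagliardo

/-! ### Convolutions of unit vector fields with an odd kernel -/

section OddKernel

/-- Convolution of a vector field with a scalar kernel. -/
noncomputable def kernelConv (K : ℝ → ℝ) (Q : ℝ → E3) : ℝ → E3 :=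
  K ⋆[ContinuousLinearMap.lsmul ℝ ℝ] Q

theorem kernelConv_apply (K : ℝ → ℝ) (Q : ℝ → E3) (x : ℝ) :
    kernelConv K Q x = ∫ t, K t • Q (x - t) := rfl

theorem locallyIntegrable_of_norm_eq_one {Q : ℝ → E3} (hQ : StronglyMeasurable Q)
    (hQ1 : ∀ x, ‖Q x‖ = 1) : LocallyIntegrable Q := by
  have hc : LocallyIntegrable (fun _ : ℝ => (1 : ℝ)) := continuous_const.locallyIntegrable
  exact hc.mono hQ.aestronglyMeasurable (Eventually.of_forall fun x => by simp [hQ1])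

theorem stronglyMeasurable_comp_sub_left {Q : ℝ → E3} (hQ : StronglyMeasurable Q) (x : ℝ) :
    StronglyMeasurable fun t => Q (x - t) :=
  hQ.comp_measurable (by fun_prop)

theorem integrable_kernel_smul {K : ℝ → ℝ} (hK : Continuous K) (hKc : HasCompactSupport K)
    {Q : ℝ → E3} (hQ : StronglyMeasurable Q) (hQ1 : ∀ x, ‖Q x‖ = 1) (x : ℝ) :
    Integrable fun t => K t • Q (x - t) :=
  (hK.integrable_of_hasCompactSupport hKc).smul_bdd 1
    (stronglyMeasurable_comp_sub_left hQ x).aestronglyMeasurable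
    (Eventually.of_forall fun _ => (hQ1 _).le)

theorem integral_eq_zero_of_odd {K : ℝ → ℝ} (hK : ∀ t, K (-t) = -K t) : ∫ t, K t = 0 := by
  have h := integral_neg_eq_self K volume
  simp only [hK, integral_neg] at h
  linarith

theorem eLpNorm_kernelConv_le {K : ℝ → ℝ} (hK : ContDiff ℝ ∞ K) (hKc : HasCompactSupport K)
    {M : ℝ} (hM0 : 0 < M) (hM : ∀ ξ, ‖𝓕 (fun t => (K t : ℂ)) ξ‖ ≤ M) {f : ℝ → E3}
    (hf : StronglyMeasurable f) :
    eLpNorm (kernelConv K f) 2 ≤ ENNReal.ofReal M * eLpNorm f 2 := by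
  by_cases h : eLpNorm f 2 = ⊤
  -- Positivity of `M` excludes 0 · ∞ = 0 when the norm of `f` is infinite.
  · rw [h, ENNReal.mul_top (by simpa using hM0)]
    exact le_top
  · exact eLpNorm_real_convolution_le hK hKc hM ⟨hf.aestronglyMeasurable, lt_top_iff_ne_top.2 h⟩

theorem contDiff_kernelConv {K : ℝ → ℝ} (hK : ContDiff ℝ ∞ K) (hKc : HasCompactSupport K)
    {Q : ℝ → E3} (hQ : StronglyMeasurable Q) (hQ1 : ∀ x, ‖Q x‖ = 1) :
    ContDiff ℝ ∞ (kernelConv K Q) :=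
  hKc.contDiff_convolution_left _ hK (locallyIntegrable_of_norm_eq_one hQ hQ1)

theorem hasDerivAt_kernelConv {K : ℝ → ℝ} (hK : ContDiff ℝ ∞ K) (hKc : HasCompactSupport K)
    {Q : ℝ → E3} (hQ : StronglyMeasurable Q) (hQ1 : ∀ x, ‖Q x‖ = 1) (x : ℝ) :
    HasDerivAt (kernelConv K Q) (kernelConv (deriv K) Q x) x :=
  hKc.hasDerivAt_convolution_left _ (hK.of_le (by simp))
    (locallyIntegrable_of_norm_eq_one hQ hQ1) x

theorem kernelConv_sub_comp {K : ℝ → ℝ} (hK : Continuous K) (hKc : HasCompactSupport K)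
    {Q : ℝ → E3} (hQ : StronglyMeasurable Q) (hQ1 : ∀ x, ‖Q x‖ = 1) (x h : ℝ) :
    kernelConv K Q x - kernelConv K Q (x - h) = kernelConv K (fun x => Q x - Q (x - h)) x := by
  simp only [kernelConv_apply]
  rw [← integral_sub (integrable_kernel_smul hK hKc hQ hQ1 x)
    (integrable_kernel_smul hK hKc hQ hQ1 (x - h))]
  refine integral_congr_ae (Eventually.of_forall fun t => ?_)
  simp only [smul_sub, sub_right_comm]

/-- Convolution commutes with translation, so the `L²` operator bound applies for each h and is then
integrated over h. -/
theorem eLpNorm_diffQuot_kernelConv_le {K : ℝ → ℝ} (hK : ContDiff ℝ ∞ K)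
    (hKc : HasCompactSupport K) {M : ℝ} (hM0 : 0 < M)
    (hM : ∀ ξ, ‖𝓕 (fun t => (K t : ℂ)) ξ‖ ≤ M) {Q : ℝ → E3}
    (hQ : StronglyMeasurable Q) (hQ1 : ∀ x, ‖Q x‖ = 1) :
    eLpNorm (diffQuot (kernelConv K Q)) 2 ≤ ENNReal.ofReal M * eLpNorm (diffQuot Q) 2 := by
  rw [← ENNReal.pow_le_pow_left_iff two_ne_zero, mul_pow, ← gagliardo_eq, ← gagliardo_eq,
    gagliardo_eq_lintegral (contDiff_kernelConv hK hKc hQ hQ1).continuous.stronglyMeasurable,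
    gagliardo_eq_lintegral hQ, ← lintegral_const_mul' _ _ (by simp)]
  refine lintegral_mono fun h => ?_
  simp only [kernelConv_sub_comp hK.continuous hKc hQ hQ1]
  rw [mul_left_comm, ← mul_pow]
  gcongr
  exact eLpNorm_kernelConv_le hK hKc hM0 hM (hQ.sub (hQ.comp_measurable (by fun_prop)))

theorem lintegral_mul_sq_le {α : Type*} [MeasurableSpace α] {μ : Measure α} {f g : α → ℝ≥0∞}
    (hf : AEMeasurable f μ) (hg : AEMeasurable g μ) :
    (∫⁻ x, f x * g x ∂μ) ^ 2 ≤ (∫⁻ x, f x ^ 2 ∂μ) * ∫⁻ x, g x ^ 2 ∂μ := by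
  have h := ENNReal.lintegral_mul_le_Lp_mul_Lq μ Real.HolderConjugate.two_two hf hg
  simp only [Pi.mul_apply, ENNReal.rpow_two] at h
  have h2 := pow_le_pow_left' h 2
  rw [mul_pow, ← ENNReal.rpow_two, ← ENNReal.rpow_two, ← ENNReal.rpow_mul,
    ← ENNReal.rpow_two ((∫⁻ x, g x ^ 2 ∂μ) ^ _), ← ENNReal.rpow_mul] at h2
  simpa using h2

/-- Convolution of a unit vector field of finite energy with an odd kernel is square
integrable. -/
theorem memLp_kernelConv {K : ℝ → ℝ} (hK : ContDiff ℝ ∞ K) (hKc : HasCompactSupport K)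
    (hodd : ∀ t, K (-t) = -K t) {Q : ℝ → E3} (hQ : StronglyMeasurable Q)
    (hQ1 : ∀ x, ‖Q x‖ = 1) (hG : gagliardo Q ≠ ⊤) : MemLp (kernelConv K Q) 2 := by
  refine ⟨(contDiff_kernelConv hK hKc hQ hQ1).continuous.aestronglyMeasurable, ?_⟩
  suffices h : eLpNorm (kernelConv K Q) 2 ^ 2 < ⊤ by
    by_contra hc
    rw [not_lt_top_iff.1 hc] at h
    simp at h
  have hzero := integral_eq_zero_of_odd hodd
  -- An odd kernel has mean zero, so the constant Q(x) can be subtracted under the integral.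
  have hrep : ∀ x, kernelConv K Q x = ∫ t, K t • (Q (x - t) - Q x) := by
    intro x
    simp only [smul_sub]
    rw [integral_sub (integrable_kernel_smul hK.continuous hKc hQ hQ1 x)
      ((hK.continuous.integrable_of_hasCompactSupport hKc).smul_const _), integral_smul_const,
      hzero, zero_smul, sub_zero, kernelConv_apply]
  -- The factor t compensates the |t|⁻¹ of the difference quotient in the Cauchy–Schwarz inequality
  -- below.
  have hKt : MemLp (fun t => t * K t) 2 :=
    (continuous_id.mul hK.continuous).memLp_of_hasCompactSupport hKc.mul_left
  have hD := hQ.diffQuot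
  have hbound : ∀ x, ‖kernelConv K Q x‖ₑ ^ 2 ≤
      eLpNorm (fun t => t * K t) 2 ^ 2 * ∫⁻ t, ‖diffQuot Q (x, x - t)‖ₑ ^ 2 := by
    intro x
    rw [hrep, eLpNorm_two_sq]
    have hmeas : Measurable fun t => ‖diffQuot Q (x, x - t)‖ₑ :=
      hD.enorm.comp (by fun_prop : Measurable fun t : ℝ => (x, x - t))
    refine le_trans ?_ (lintegral_mul_sq_le hKt.aestronglyMeasurable.enorm hmeas.aemeasurable)
    gcongr
    refine (enorm_integral_le_lintegral_enorm _).trans (lintegral_mono_ae ?_)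
    have hne : ∀ᵐ t : ℝ, t ≠ 0 := by simp [ae_iff, measure_singleton]
    filter_upwards [hne] with t ht
    refine le_of_eq ?_
    simp only [diffQuot, enorm_smul, enorm_mul, _root_.sub_sub_cancel]
    rw [enorm_sub_rev (Q (x - t))]
    have e1 : ‖t‖ₑ * ‖|t|⁻¹‖ₑ = 1 := by
      rw [← enorm_mul, ← ofReal_norm, norm_mul, norm_inv, Real.norm_eq_abs, Real.norm_eq_abs,
        abs_abs, mul_inv_cancel₀ (abs_ne_zero.2 ht), ENNReal.ofReal_one]
    calc ‖K t‖ₑ * ‖Q x - Q (x - t)‖ₑ = (‖t‖ₑ * ‖|t|⁻¹‖ₑ) * (‖K t‖ₑ * ‖Q x - Q (x - t)‖ₑ) := by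
          rw [e1, one_mul]
      _ = _ := by ring
  rw [eLpNorm_two_sq]
  refine (lintegral_mono hbound).trans_lt ?_
  have hfin : eLpNorm (fun t => t * K t) 2 ^ 2 ≠ ⊤ := ENNReal.pow_ne_top hKt.eLpNorm_ne_top
  rw [lintegral_const_mul' _ _ hfin]
  refine ENNReal.mul_lt_top (lt_top_iff_ne_top.2 hfin) ?_
  rw [lintegral_lintegral_swap (f := fun x t => ‖diffQuot Q (x, x - t)‖ₑ ^ 2) ((hD.enorm.pow_const 2).comp
    (by fun_prop : Measurable fun p : ℝ × ℝ => (p.1, p.1 - p.2))).aemeasurable,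
    ← lintegral_prod_eq_lintegral_sub (hD.enorm.pow_const 2), ← eLpNorm_two_sq, ← gagliardo_eq]
  exact lt_top_iff_ne_top.2 hG

end OddKernel

/-! ### Cutoffs at infinity -/

section Cutoff

theorem integral_deriv_eq_zero_of_hasCompactSupport {E : Type*} [NormedAddCommGroup E]
    [NormedSpace ℝ E] {f : ℝ → E} (hf : ContDiff ℝ ∞ f) (hfc : HasCompactSupport f) :
    ∫ x, deriv f x = 0 :=
  integral_eq_zero_of_hasDerivAt_of_integrable
    (fun x => (hf.differentiable (by simp) x).hasDerivAt)
    ((hf.continuous_deriv (by simp)).integrable_of_hasCompactSupport hfc.deriv)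
    (hf.continuous.integrable_of_hasCompactSupport hfc)

/-- The cutoff function at scale `n + 1`. -/
noncomputable def scaledCutoff (n : ℕ) (x : ℝ) : ℝ := cutoff (x / ((n : ℝ) + 1))

theorem contDiff_scaledCutoff (n : ℕ) : ContDiff ℝ ∞ (scaledCutoff n) :=
  cutoff.contDiff.comp (contDiff_id.div_const _)

theorem scaledCutoff_nonneg (n : ℕ) (x : ℝ) : 0 ≤ scaledCutoff n x := cutoff.nonneg

theorem scaledCutoff_le_one (n : ℕ) (x : ℝ) : scaledCutoff n x ≤ 1 := cutoff.le_one

theorem norm_scaledCutoff_le_one (n : ℕ) (x : ℝ) : ‖scaledCutoff n x‖ ≤ 1 := by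
  rw [Real.norm_eq_abs, abs_of_nonneg (scaledCutoff_nonneg n x)]
  exact scaledCutoff_le_one n x

theorem hasCompactSupport_scaledCutoff (n : ℕ) : HasCompactSupport (scaledCutoff n) := by
  have hn : (0 : ℝ) < (n : ℝ) + 1 := by positivity
  refine HasCompactSupport.intro
    (isCompact_Icc (a := -(2 * ((n : ℝ) + 1))) (b := 2 * ((n : ℝ) + 1))) fun x hx => ?_
  rw [Set.mem_Icc, ← abs_le, not_le] at hx
  refine cutoff_eq_zero ?_
  rw [abs_div, abs_of_pos hn, le_div_iff₀ hn]
  exact hx.le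

theorem eventually_scaledCutoff_eq_one (x : ℝ) :
    ∀ᶠ n in atTop, scaledCutoff n =ᶠ[𝓝 x] fun _ => 1 := by
  filter_upwards [tendsto_natCast_atTop_atTop.eventually_gt_atTop |x|] with n hn
  filter_upwards [(continuous_abs.tendsto x).eventually_lt_const hn] with y hy
  have hn1 : (0 : ℝ) < (n : ℝ) + 1 := by positivity
  refine cutoff_eq_one ?_
  rw [abs_div, abs_of_pos hn1, div_le_one hn1]
  linarith

theorem tendsto_scaledCutoff (x : ℝ) : Tendsto (fun n => scaledCutoff n x) atTop (𝓝 1) :=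
  tendsto_const_nhds.congr'
    ((eventually_scaledCutoff_eq_one x).mono fun _ hn => hn.self_of_nhds.symm)

theorem tendsto_deriv_scaledCutoff (x : ℝ) :
    Tendsto (fun n => deriv (scaledCutoff n) x) atTop (𝓝 0) := by
  refine tendsto_const_nhds.congr' ((eventually_scaledCutoff_eq_one x).mono fun n hn => ?_)
  simp [hn.deriv_eq]

/-- Both bounds are uniform in n and serve as dominating functions: (1 + x²)^(-1/2) is in `L²`, and
(1 + (x - y)²)⁻¹ is integrable in x uniformly in y. -/
theorem exists_scaledCutoff_bound :
    ∃ C : ℝ, 0 ≤ C ∧ (∀ n x, |deriv (scaledCutoff n) x| ≤ C * (√(1 + x ^ 2))⁻¹) ∧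
      ∀ n x y, (|x - y|⁻¹ * (scaledCutoff n x - scaledCutoff n y)) ^ 2 ≤
        C * (1 + (x - y) ^ 2)⁻¹ := by
  obtain ⟨C, hC0, hC1, hC2⟩ := exists_deriv_cutoff_bound
  have hd : ∀ n x, |deriv (scaledCutoff n) x| ≤ C ∧ |deriv (scaledCutoff n) x| * |x| ≤ C := by
    intro n x
    have hn : (1 : ℝ) ≤ (n : ℝ) + 1 := by simp
    have hn0 : (0 : ℝ) < (n : ℝ) + 1 := by positivity
    have hc : HasDerivAt cutoff (deriv cutoff (x / ((n : ℝ) + 1))) (x / ((n : ℝ) + 1)) :=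
      ((cutoff.contDiff (n := 1)).differentiable one_ne_zero _).hasDerivAt
    have h1 : HasDerivAt (scaledCutoff n)
        (deriv cutoff (x / ((n : ℝ) + 1)) * (1 / ((n : ℝ) + 1))) x :=
      HasDerivAt.comp (h₂ := fun y : ℝ => cutoff y) x hc
        ((hasDerivAt_id x).div_const ((n : ℝ) + 1))
    rw [h1.deriv, abs_mul, abs_of_pos (show 0 < 1 / ((n : ℝ) + 1) by positivity)]
    constructor
    · calc _ ≤ |deriv cutoff (x / ((n : ℝ) + 1))| * 1 := by
            gcongr
            exact div_le_one_of_le₀ hn hn0.le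
        _ ≤ C := by rw [mul_one]; exact hC1 _
    · have := hC2 (x / ((n : ℝ) + 1))
      rw [abs_div, abs_of_pos hn0] at this
      calc _ = _ := by ring
        _ ≤ C := this
  -- The first bound needs 2C; the second needs C² + 1, from the Lipschitz bound and from values in
  -- [0, 1].
  refine ⟨2 * C + 1 + C ^ 2, by positivity, fun n x => ?_, fun n x y => ?_⟩
  · obtain ⟨h1, h2⟩ := hd n x
    rw [← div_eq_mul_inv, le_div_iff₀ (by positivity)]
    have h3 : √(1 + x ^ 2) ≤ 1 + |x| := by
      rw [Real.sqrt_le_left (by positivity)]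
      nlinarith [abs_nonneg x, sq_abs x]
    calc _ ≤ |deriv (scaledCutoff n) x| * (1 + |x|) := by gcongr
      _ = |deriv (scaledCutoff n) x| + |deriv (scaledCutoff n) x| * |x| := by ring
      _ ≤ _ := by nlinarith
  · have hlip : |scaledCutoff n x - scaledCutoff n y| ≤ C * |x - y| :=
      Convex.norm_image_sub_le_of_norm_deriv_le (f := scaledCutoff n) (s := Set.univ)
        (fun z _ => (contDiff_scaledCutoff n).differentiable (by simp) z)
        (fun z _ => (hd n z).1) convex_univ trivial trivial
    have hone : |scaledCutoff n x - scaledCutoff n y| ≤ 1 := by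
      have h1 := scaledCutoff_nonneg n x
      have h2 := scaledCutoff_le_one n x
      have h3 := scaledCutoff_nonneg n y
      have h4 := scaledCutoff_le_one n y
      rw [abs_le]
      constructor <;> linarith
    rcases eq_or_ne x y with rfl | hxy
    · simp
      positivity
    have hu : 0 < |x - y| := abs_pos.2 (sub_ne_zero.2 hxy)
    rw [← div_eq_mul_inv, le_div_iff₀ (by positivity), mul_pow, ← sq_abs (scaledCutoff n x - _),
      inv_pow, ← sq_abs (x - y)]
    have q1 := pow_le_pow_left₀ (abs_nonneg _) hlip 2
    have q2 := pow_le_pow_left₀ (abs_nonneg _) hone 2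
    generalize |scaledCutoff n x - scaledCutoff n y| = d at *
    generalize |x - y| = u at *
    calc (u ^ 2)⁻¹ * d ^ 2 * (1 + u ^ 2) = (u ^ 2)⁻¹ * d ^ 2 + d ^ 2 := by field_simp
      _ ≤ (u ^ 2)⁻¹ * (C * u) ^ 2 + 1 ^ 2 := by gcongr
      _ = C ^ 2 + 1 := by field_simp
      _ ≤ _ := by linarith

/-- Leibniz rule for differences: η(x)(ψ(x) - ψ(y)) + (η(x) - η(y))ψ(y), with |η| ≤ 1. -/
theorem eLpNorm_diffQuot_scaledCutoff_smul_le {ψ : ℝ → E3} (hψ : StronglyMeasurable ψ) (n : ℕ) :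
    eLpNorm (diffQuot fun x => scaledCutoff n x • ψ x) 2 ≤ eLpNorm (diffQuot ψ) 2 +
      eLpNorm (fun z : ℝ × ℝ =>
        (|z.1 - z.2|⁻¹ * (scaledCutoff n z.1 - scaledCutoff n z.2)) • ψ z.2) 2 := by
  have hc := (contDiff_scaledCutoff n).continuous
  have e : (diffQuot fun x => scaledCutoff n x • ψ x) =
      (fun z : ℝ × ℝ => scaledCutoff n z.1 • diffQuot ψ z) + fun z : ℝ × ℝ =>
        (|z.1 - z.2|⁻¹ * (scaledCutoff n z.1 - scaledCutoff n z.2)) • ψ z.2 := by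
    ext1 z
    simp only [diffQuot, Pi.add_apply]
    module
  have m1 : StronglyMeasurable fun z : ℝ × ℝ => scaledCutoff n z.1 • diffQuot ψ z :=
    (hc.comp continuous_fst).stronglyMeasurable.smul hψ.diffQuot
  have m2 : StronglyMeasurable fun z : ℝ × ℝ =>
      (|z.1 - z.2|⁻¹ * (scaledCutoff n z.1 - scaledCutoff n z.2)) • ψ z.2 :=
    StronglyMeasurable.smul
      (by fun_prop : Measurable fun z : ℝ × ℝ =>
        |z.1 - z.2|⁻¹ * (scaledCutoff n z.1 - scaledCutoff n z.2)).stronglyMeasurable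
      (hψ.comp_measurable measurable_snd)
  rw [e]
  refine (eLpNorm_add_le m1.aestronglyMeasurable m2.aestronglyMeasurable (by norm_num)).trans ?_
  gcongr
  refine eLpNorm_mono fun z => ?_
  rw [norm_smul]
  exact mul_le_of_le_one_left (norm_nonneg _) (norm_scaledCutoff_le_one n _)

/-- Dominated convergence with majorant C(1 + (x - y)²)⁻¹|ψ(y)|², integrable because ψ is in `L²`;
pointwise the cutoffs at x and y are eventually both 1. -/
theorem tendsto_eLpNorm_scaledCutoff_commutator {ψ : ℝ → E3} (hψ : StronglyMeasurable ψ)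
    (hψ2 : MemLp ψ 2) :
    Tendsto (fun n => eLpNorm (fun z : ℝ × ℝ =>
        (|z.1 - z.2|⁻¹ * (scaledCutoff n z.1 - scaledCutoff n z.2)) • ψ z.2) 2) atTop (𝓝 0) := by
  obtain ⟨C, hC0, -, hC⟩ := exists_scaledCutoff_bound
  have hmain : Tendsto (fun n => ∫⁻ z : ℝ × ℝ, ‖(|z.1 - z.2|⁻¹ *
      (scaledCutoff n z.1 - scaledCutoff n z.2)) • ψ z.2‖ₑ ^ 2) atTop
      (𝓝 (∫⁻ _ : ℝ × ℝ, 0)) := by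
    refine tendsto_lintegral_of_dominated_convergence (fun z : ℝ × ℝ =>
      ENNReal.ofReal (C * (1 + (z.1 - z.2) ^ 2)⁻¹) * ‖ψ z.2‖ₑ ^ 2) (fun n => ?_) (fun n => ?_) ?_ ?_
    · have hc := (contDiff_scaledCutoff n).continuous
      refine (StronglyMeasurable.enorm (StronglyMeasurable.smul
        (by fun_prop : Measurable fun z : ℝ × ℝ =>
          |z.1 - z.2|⁻¹ * (scaledCutoff n z.1 - scaledCutoff n z.2)).stronglyMeasurable
        (hψ.comp_measurable measurable_snd))).pow_const 2
    · refine Eventually.of_forall fun z => ?_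
      simp only [enorm_smul, mul_pow]
      gcongr
      rw [← ofReal_norm, ← ENNReal.ofReal_pow (norm_nonneg _), Real.norm_eq_abs, sq_abs]
      exact ENNReal.ofReal_le_ofReal (hC n z.1 z.2)
    · have hm1 : Measurable fun z : ℝ × ℝ => ENNReal.ofReal (C * (1 + (z.1 - z.2) ^ 2)⁻¹) := by
        fun_prop
      have hm2 : Measurable fun z : ℝ × ℝ => ‖ψ z.2‖ₑ ^ 2 :=
        (hψ.comp_measurable measurable_snd).enorm.pow_const 2
      rw [Measure.volume_eq_prod, lintegral_prod_symm (fun z : ℝ × ℝ =>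
        ENNReal.ofReal (C * (1 + (z.1 - z.2) ^ 2)⁻¹) * ‖ψ z.2‖ₑ ^ 2) (hm1.mul hm2).aemeasurable]
      have hin : ∀ y : ℝ, ∫⁻ x : ℝ, ENNReal.ofReal (C * (1 + (x - y) ^ 2)⁻¹) * ‖ψ y‖ₑ ^ 2 =
          (∫⁻ x : ℝ, ENNReal.ofReal (C * (1 + x ^ 2)⁻¹)) * ‖ψ y‖ₑ ^ 2 := by
        intro y
        rw [lintegral_mul_const' _ _ (by simp),
          lintegral_sub_right_eq_self (fun x => ENNReal.ofReal (C * (1 + x ^ 2)⁻¹)) y]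
      have hfin : ∫⁻ x : ℝ, ENNReal.ofReal (C * (1 + x ^ 2)⁻¹) ≠ ⊤ :=
        (integrable_inv_one_add_sq.const_mul C).lintegral_lt_top.ne
      simp only [hin]
      rw [lintegral_const_mul' _ _ hfin, ← eLpNorm_two_sq]
      exact ENNReal.mul_ne_top hfin (ENNReal.pow_ne_top hψ2.eLpNorm_ne_top)
    · refine Eventually.of_forall fun z => tendsto_const_nhds.congr' ?_
      filter_upwards [eventually_scaledCutoff_eq_one z.1, eventually_scaledCutoff_eq_one z.2]
        with n h1 h2
      simp [h1.self_of_nhds, h2.self_of_nhds]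
  rw [lintegral_zero] at hmain
  have h2 := (ENNReal.continuous_rpow_const (y := 1 / 2)).tendsto 0 |>.comp hmain
  rw [ENNReal.zero_rpow_of_pos (by norm_num)] at h2
  refine h2.congr fun n => ?_
  rw [Function.comp_apply, ← eLpNorm_two_sq, ← ENNReal.rpow_two, ← ENNReal.rpow_mul]
  simp

end Cutoff

/-! ### The tested derivative term as the cutoffs are removed -/

section Limit

variable {K : ℝ → ℝ} {Q : ℝ → E3}

theorem memLp_diffQuot (hQ : StronglyMeasurable Q) (hG : gagliardo Q ≠ ⊤) :
    MemLp (diffQuot Q) 2 := by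
  refine ⟨hQ.diffQuot.aestronglyMeasurable, lt_top_iff_ne_top.2 fun h => hG ?_⟩
  rw [gagliardo_eq, h]
  simp

theorem integrable_norm_diffQuot_sq (hQ : StronglyMeasurable Q) (hG : gagliardo Q ≠ ⊤) :
    Integrable fun z => ‖diffQuot Q z‖ ^ 2 :=
  (memLp_two_iff_integrable_sq_norm hQ.diffQuot.aestronglyMeasurable).1 (memLp_diffQuot hQ hG)

theorem norm_deriv_kernel_mul_sq_le {C : ℝ} (hC : ∀ h, |deriv K h| * h ^ 2 ≤ C) (Q : ℝ → E3)
    (z : ℝ × ℝ) :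
    ‖deriv K (z.1 - z.2) * ‖Q z.1 - Q z.2‖ ^ 2‖ ≤ C * ‖diffQuot Q z‖ ^ 2 := by
  rw [norm_diffQuot_sq, norm_mul, Real.norm_eq_abs, Real.norm_eq_abs,
    abs_of_nonneg (by positivity : 0 ≤ ‖Q z.1 - Q z.2‖ ^ 2)]
  rcases eq_or_ne z.1 z.2 with h | h
  · simp [h]
  · have hu : 0 < |z.1 - z.2| ^ 2 := by
      have := abs_pos.2 (sub_ne_zero.2 h)
      positivity
    rw [← mul_div_assoc, le_div_iff₀ hu, sq_abs]
    calc _ = |deriv K (z.1 - z.2)| * (z.1 - z.2) ^ 2 * ‖Q z.1 - Q z.2‖ ^ 2 := by ring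
      _ ≤ _ := by gcongr; exact hC _

theorem integrable_deriv_kernel_mul_sq (hK : ContDiff ℝ ∞ K) {C : ℝ}
    (hC : ∀ h, |deriv K h| * h ^ 2 ≤ C) (hQ : StronglyMeasurable Q) (hG : gagliardo Q ≠ ⊤) :
    Integrable fun z : ℝ × ℝ => deriv K (z.1 - z.2) * ‖Q z.1 - Q z.2‖ ^ 2 := by
  have hd := hK.continuous_deriv (by simp)
  refine ((integrable_norm_diffQuot_sq hQ hG).const_mul C).mono' ?_
    (Eventually.of_forall (norm_deriv_kernel_mul_sq_le hC Q))
  exact ((hd.comp (continuous_fst.sub continuous_snd)).stronglyMeasurable.mul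
    (((hQ.comp_measurable measurable_fst).sub
      (hQ.comp_measurable measurable_snd)).norm.pow 2)).aestronglyMeasurable

/-- Unit length gives Q(x) · Q(y) = 1 - |Q(x) - Q(y)|²/2, and the constant drops out because K' has
integral zero. -/
theorem inner_kernelConv_deriv (hK : ContDiff ℝ ∞ K) (hKc : HasCompactSupport K)
    (hQ : StronglyMeasurable Q) (hQ1 : ∀ x, ‖Q x‖ = 1) (x : ℝ) :
    inner ℝ (Q x) (kernelConv (deriv K) Q x) =
      -(1 / 2) * ∫ y, deriv K (x - y) * ‖Q x - Q y‖ ^ 2 := by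
  have hd := hK.continuous_deriv (by simp)
  have hdi : Integrable (deriv K) := hd.integrable_of_hasCompactSupport hKc.deriv
  rw [kernelConv_apply, ← integral_inner (integrable_kernel_smul hd hKc.deriv hQ hQ1 x)]
  have e : ∀ t, inner ℝ (Q x) (deriv K t • Q (x - t)) =
      deriv K t - 1 / 2 * (deriv K t * ‖Q x - Q (x - t)‖ ^ 2) := by
    intro t
    rw [real_inner_smul_right, norm_sub_sq_real, hQ1, hQ1]
    ring
  have hi : Integrable fun t => deriv K t * ‖Q x - Q (x - t)‖ ^ 2 := by
    refine hdi.mul_bdd (c := 4) ?_ (Eventually.of_forall fun t => ?_)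
    · exact (((stronglyMeasurable_const.sub
        (stronglyMeasurable_comp_sub_left hQ x)).norm).pow 2).aestronglyMeasurable
    · have h1 := norm_sub_le (Q x) (Q (x - t))
      rw [hQ1, hQ1] at h1
      rw [Real.norm_eq_abs, abs_of_nonneg (by positivity)]
      nlinarith [norm_nonneg (Q x - Q (x - t))]
  simp only [e]
  rw [integral_sub hdi (hi.const_mul _), integral_deriv_eq_zero_of_hasCompactSupport hK hKc,
    integral_const_mul, ← integral_sub_left_eq_self _ volume x]
  simp only [_root_.sub_sub_cancel]
  ring

/-- By the product rule, the term with the derivative on K ⋆ Q converges to the stated double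
integral, while the one with the derivative on the cutoff tends to zero. -/
theorem tendsto_integral_inner_deriv_scaledCutoff_smul (hK : ContDiff ℝ ∞ K)
    (hKc : HasCompactSupport K) (hodd : ∀ t, K (-t) = -K t) {C : ℝ}
    (hC : ∀ h, |deriv K h| * h ^ 2 ≤ C) (hQ : StronglyMeasurable Q) (hQ1 : ∀ x, ‖Q x‖ = 1)
    (hG : gagliardo Q ≠ ⊤) :
    Tendsto (fun n => ∫ x, inner ℝ (Q x)
        (deriv (fun x => scaledCutoff n x • kernelConv K Q x) x)) atTop
      (𝓝 (-(1 / 2) * ∫ z : ℝ × ℝ, deriv K (z.1 - z.2) * ‖Q z.1 - Q z.2‖ ^ 2)) := by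
  obtain ⟨B, hB0, hB, -⟩ := exists_scaledCutoff_bound
  have hψ2 := memLp_kernelConv hK hKc hodd hQ hQ1 hG
  have hψc := (contDiff_kernelConv hK hKc hQ hQ1).continuous
  have hk := integrable_deriv_kernel_mul_sq hK hC hQ hG
  have hk' := hk
  rw [Measure.volume_eq_prod] at hk'
  have hp : Integrable fun x => inner ℝ (Q x) (kernelConv (deriv K) Q x) := by
    simp only [inner_kernelConv_deriv hK hKc hQ hQ1]
    exact hk'.integral_prod_left.const_mul _
  have hpint : ∫ x, inner ℝ (Q x) (kernelConv (deriv K) Q x) =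
      -(1 / 2) * ∫ z : ℝ × ℝ, deriv K (z.1 - z.2) * ‖Q z.1 - Q z.2‖ ^ 2 := by
    simp only [inner_kernelConv_deriv hK hKc hQ hQ1]
    rw [integral_const_mul, Measure.volume_eq_prod, integral_prod _ hk']
  have hder : ∀ n x, inner ℝ (Q x) (deriv (fun x => scaledCutoff n x • kernelConv K Q x) x) =
      scaledCutoff n x * inner ℝ (Q x) (kernelConv (deriv K) Q x) +
      deriv (scaledCutoff n) x * inner ℝ (Q x) (kernelConv K Q x) := by
    intro n x
    have h1 : HasDerivAt (scaledCutoff n) (deriv (scaledCutoff n) x) x :=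
      ((contDiff_scaledCutoff n).differentiable (by simp) x).hasDerivAt
    have h2 := h1.smul (hasDerivAt_kernelConv hK hKc hQ hQ1 x)
    have h3 : deriv (fun x => scaledCutoff n x • kernelConv K Q x) x = _ := h2.deriv
    rw [h3, inner_add_right, real_inner_smul_right, real_inner_smul_right]
  -- A product of two `L²` functions; this is where square integrability of K ⋆ Q enters.
  have hdom : Integrable fun x => B * (√(1 + x ^ 2))⁻¹ * ‖kernelConv K Q x‖ := by
    have h1 : MemLp (fun x : ℝ => B * (√(1 + x ^ 2))⁻¹) 2 := by
      have hcont : Continuous fun x : ℝ => B * (√(1 + x ^ 2))⁻¹ :=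
        continuous_const.mul ((by fun_prop : Continuous fun x : ℝ => √(1 + x ^ 2)).inv₀
          fun x => by positivity)
      rw [memLp_two_iff_integrable_sq hcont.aestronglyMeasurable]
      refine (integrable_inv_one_add_sq.const_mul (B ^ 2)).congr
        (Eventually.of_forall fun x => ?_)
      simp only [mul_pow, inv_pow]
      rw [Real.sq_sqrt (by positivity)]
    exact h1.integrable_mul hψ2.norm
  have hqm : AEStronglyMeasurable (fun x => inner ℝ (Q x) (kernelConv K Q x)) volume :=
    hQ.aestronglyMeasurable.inner hψc.aestronglyMeasurable
  have hqb : ∀ n x, ‖deriv (scaledCutoff n) x * inner ℝ (Q x) (kernelConv K Q x)‖ ≤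
      B * (√(1 + x ^ 2))⁻¹ * ‖kernelConv K Q x‖ := by
    intro n x
    rw [norm_mul, Real.norm_eq_abs]
    have := norm_inner_le_norm (𝕜 := ℝ) (Q x) (kernelConv K Q x)
    rw [hQ1, one_mul] at this
    exact mul_le_mul (hB n x) this (norm_nonneg _) (by positivity)
  have hm1 : ∀ n, AEStronglyMeasurable (fun x =>
      scaledCutoff n x * inner ℝ (Q x) (kernelConv (deriv K) Q x)) volume := fun n =>
    (contDiff_scaledCutoff n).continuous.aestronglyMeasurable.mul hp.aestronglyMeasurable
  have hm2 : ∀ n, AEStronglyMeasurable (fun x =>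
      deriv (scaledCutoff n) x * inner ℝ (Q x) (kernelConv K Q x)) volume := fun n =>
    ((contDiff_scaledCutoff n).continuous_deriv (by simp)).aestronglyMeasurable.mul hqm
  have hb1 : ∀ n x, ‖scaledCutoff n x * inner ℝ (Q x) (kernelConv (deriv K) Q x)‖ ≤
      ‖(inner ℝ (Q x) (kernelConv (deriv K) Q x) : ℝ)‖ := by
    intro n x
    rw [norm_mul]
    exact mul_le_of_le_one_left (norm_nonneg _) (norm_scaledCutoff_le_one n x)
  have l1 := tendsto_integral_of_dominated_convergence _ hm1 hp.norm
    (fun n => Eventually.of_forall (hb1 n))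
    (Eventually.of_forall fun x => (tendsto_scaledCutoff x).mul_const _)
  have l2 := tendsto_integral_of_dominated_convergence _ hm2 hdom
    (fun n => Eventually.of_forall (hqb n))
    (Eventually.of_forall fun x => (tendsto_deriv_scaledCutoff x).mul_const _)
  have l3 := l1.add l2
  simp only [one_mul, zero_mul, integral_zero, add_zero, hpint] at l3
  refine l3.congr fun n => ?_
  simp only [hder]
  rw [integral_add (hp.norm.mono' (hm1 n) (Eventually.of_forall (hb1 n)))
    (hdom.mono' (hm2 n) (Eventually.of_forall (hqb n)))]

end Limit

/-! ### Triviality for `|v| ≥ 1` -/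

section Triviality

variable {v : ℝ} {Q : ℝ → E3}

theorem memLp_wedgeQuot (hQ : StronglyMeasurable Q) (hQ1 : ∀ x, ‖Q x‖ = 1)
    (hG : gagliardo Q ≠ ⊤) : MemLp (wedgeQuot Q) 2 :=
  (memLp_diffQuot hQ hG).mono hQ.wedgeQuot.aestronglyMeasurable
    (Eventually.of_forall (norm_wedgeQuot_le hQ1))

/-- The profile equation tested with the convolution `K ⋆ Q`. -/
theorem SolvesProfile.ofReal_kernel_le (h : SolvesProfile v Q) (hQ : StronglyMeasurable Q)
    (hQ1 : ∀ x, ‖Q x‖ = 1) (hG : gagliardo Q ≠ ⊤) {K : ℝ → ℝ} (hK : ContDiff ℝ ∞ K)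
    (hKc : HasCompactSupport K) (hodd : ∀ t, K (-t) = -K t) {C M : ℝ}
    (hC : ∀ h, |deriv K h| * h ^ 2 ≤ C) (hM0 : 0 < M)
    (hM : ∀ ξ, ‖𝓕 (fun t => (K t : ℂ)) ξ‖ ≤ M) :
    ENNReal.ofReal (2 * Real.pi * |v| *
        |-(1 / 2) * ∫ z : ℝ × ℝ, deriv K (z.1 - z.2) * ‖Q z.1 - Q z.2‖ ^ 2|) ≤
      ENNReal.ofReal M * (eLpNorm (diffQuot Q) 2 * eLpNorm (wedgeQuot Q) 2) := by
  have hψ := contDiff_kernelConv hK hKc hQ hQ1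
  have hψm := hψ.continuous.stronglyMeasurable
  have hw := (memLp_wedgeQuot hQ hQ1 hG).eLpNorm_ne_top
  have hle : ∀ n, ENNReal.ofReal (2 * Real.pi * |v| * |∫ x, inner ℝ (Q x)
      (deriv (fun x => scaledCutoff n x • kernelConv K Q x) x)|) ≤
      (ENNReal.ofReal M * eLpNorm (diffQuot Q) 2 + eLpNorm (fun z : ℝ × ℝ =>
        (|z.1 - z.2|⁻¹ * (scaledCutoff n z.1 - scaledCutoff n z.2)) • kernelConv K Q z.2) 2) *
        eLpNorm (wedgeQuot Q) 2 := by
    intro n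
    refine (h.ofReal_abs_integral_le hQ ((contDiff_scaledCutoff n).smul hψ)
      (hasCompactSupport_scaledCutoff n).smul_right).trans ?_
    gcongr
    refine (eLpNorm_diffQuot_scaledCutoff_smul_le hψm n).trans ?_
    gcongr
    exact eLpNorm_diffQuot_kernelConv_le hK hKc hM0 hM hQ hQ1
  have l1 := ENNReal.tendsto_ofReal
    ((tendsto_integral_inner_deriv_scaledCutoff_smul hK hKc hodd hC hQ hQ1 hG).abs.const_mul
      (2 * Real.pi * |v|))
  have l2 := ENNReal.Tendsto.mul_const ((tendsto_eLpNorm_scaledCutoff_commutator hψm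
    (memLp_kernelConv hK hKc hodd hQ hQ1 hG)).const_add
      (ENNReal.ofReal M * eLpNorm (diffQuot Q) 2)) (Or.inr hw)
  rw [add_zero, mul_assoc] at l2
  exact le_of_tendsto_of_tendsto' l1 l2 hle

theorem tendsto_integral_deriv_hilbertKernel (hQ : StronglyMeasurable Q) (hG : gagliardo Q ≠ ⊤) :
    Tendsto (fun n : ℕ => ∫ z : ℝ × ℝ,
      deriv (hilbertKernel ((n : ℝ) + 1)) (z.1 - z.2) * ‖Q z.1 - Q z.2‖ ^ 2) atTop
      (𝓝 (∫ z : ℝ × ℝ, -(Real.pi)⁻¹ * ‖diffQuot Q z‖ ^ 2)) := by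
  obtain ⟨C, hC⟩ := exists_deriv_hilbertKernel_bound
  have hr : ∀ n : ℕ, (1 : ℝ) ≤ (n : ℝ) + 1 := fun n => by simp
  have hrt : Tendsto (fun n : ℕ => (n : ℝ) + 1) atTop atTop :=
    tendsto_atTop_add_const_right _ _ tendsto_natCast_atTop_atTop
  refine tendsto_integral_of_dominated_convergence (fun z => C * ‖diffQuot Q z‖ ^ 2)
    (fun n => (integrable_deriv_kernel_mul_sq (contDiff_hilbertKernel (hr n)) (hC _ (hr n)) hQ
      hG).aestronglyMeasurable) ((integrable_norm_diffQuot_sq hQ hG).const_mul C)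
    (fun n => Eventually.of_forall (norm_deriv_kernel_mul_sq_le (hC _ (hr n)) Q))
    (Eventually.of_forall fun z => ?_)
  rcases eq_or_ne z.1 z.2 with hz | hz
  · simp [hz, diffQuot]
  · have e : -(Real.pi)⁻¹ * ‖diffQuot Q z‖ ^ 2 =
        -(Real.pi * (z.1 - z.2) ^ 2)⁻¹ * ‖Q z.1 - Q z.2‖ ^ 2 := by
      rw [norm_diffQuot_sq, sq_abs, mul_inv]
      ring
    rw [e]
    exact ((tendsto_deriv_hilbertKernel (sub_ne_zero.2 hz)).comp hrt).mul_const _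

/-- The energy estimate resulting from the test function `H Q`, with `H` the Hilbert transform. -/
theorem SolvesProfile.ofReal_energy_le (h : SolvesProfile v Q) (hQ : StronglyMeasurable Q)
    (hQ1 : ∀ x, ‖Q x‖ = 1) (hG : gagliardo Q ≠ ⊤) :
    ENNReal.ofReal (|v| * ∫ z, ‖diffQuot Q z‖ ^ 2) ≤
      eLpNorm (diffQuot Q) 2 * eLpNorm (wedgeQuot Q) 2 := by
  obtain ⟨C, hC⟩ := exists_deriv_hilbertKernel_bound
  have hpi := Real.pi_pos
  have hr : ∀ n : ℕ, (1 : ℝ) ≤ (n : ℝ) + 1 := fun n => by simp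
  have hrt : Tendsto (fun n : ℕ => (n : ℝ) + 1) atTop atTop :=
    tendsto_atTop_add_const_right _ _ tendsto_natCast_atTop_atTop
  have hle : ∀ n : ℕ, ENNReal.ofReal (2 * Real.pi * |v| * |-(1 / 2) * ∫ z : ℝ × ℝ,
      deriv (hilbertKernel ((n : ℝ) + 1)) (z.1 - z.2) * ‖Q z.1 - Q z.2‖ ^ 2|) ≤
      ENNReal.ofReal (1 + 2 / ((n : ℝ) + 1)) *
        (eLpNorm (diffQuot Q) 2 * eLpNorm (wedgeQuot Q) 2) := fun n =>
    h.ofReal_kernel_le hQ hQ1 hG (contDiff_hilbertKernel (hr n))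
      (hasCompactSupport_hilbertKernel (hr n)) (hilbertKernel_neg _) (hC _ (hr n))
      (by positivity) (norm_fourier_hilbertKernel_le (hr n))
  have l1 := ENNReal.tendsto_ofReal
    (((tendsto_integral_deriv_hilbertKernel hQ hG).const_mul (-(1 / 2))).abs.const_mul
      (2 * Real.pi * |v|))
  have lM : Tendsto (fun n : ℕ => ENNReal.ofReal (1 + 2 / ((n : ℝ) + 1))) atTop (𝓝 1) := by
    rw [← ENNReal.ofReal_one]
    refine ENNReal.tendsto_ofReal ?_
    simpa using (hrt.const_div_atTop 2).const_add 1
  have hfin : eLpNorm (diffQuot Q) 2 * eLpNorm (wedgeQuot Q) 2 ≠ ⊤ :=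
    ENNReal.mul_ne_top (memLp_diffQuot hQ hG).eLpNorm_ne_top
      (memLp_wedgeQuot hQ hQ1 hG).eLpNorm_ne_top
  have hnn : 0 ≤ ∫ z, ‖diffQuot Q z‖ ^ 2 := integral_nonneg fun z => by positivity
  -- The constants cancel: 2π · (1/2) · π⁻¹ = 1.
  have e : 2 * Real.pi * |v| * |-(1 / 2) * ∫ z : ℝ × ℝ, -(Real.pi)⁻¹ * ‖diffQuot Q z‖ ^ 2| =
      |v| * ∫ z, ‖diffQuot Q z‖ ^ 2 := by
    rw [integral_const_mul, ← mul_assoc (-(1 / 2)), abs_mul, abs_of_nonneg hnn, neg_mul_neg,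
      abs_of_pos (by positivity : 0 < 1 / 2 * Real.pi⁻¹)]
    field_simp
  rw [e] at l1
  generalize eLpNorm (diffQuot Q) 2 volume * eLpNorm (wedgeQuot Q) 2 volume = B at *
  have l2 := ENNReal.Tendsto.mul_const lM (b := B) (Or.inr hfin)
  rw [one_mul] at l2
  exact le_of_tendsto_of_tendsto' l1 l2 hle

theorem toReal_eLpNorm_two_sq {α F : Type*} [MeasurableSpace α] [NormedAddCommGroup F]
    {μ : Measure α} {f : α → F} (hf : MemLp f 2 μ) :
    (eLpNorm f 2 μ).toReal ^ 2 = ∫ x, ‖f x‖ ^ 2 ∂μ := by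
  rw [← ENNReal.toReal_pow, eLpNorm_two_sq, integral_eq_lintegral_of_nonneg_ae
    (f := fun x => ‖f x‖ ^ 2) (Eventually.of_forall fun x => by positivity)
    (hf.aestronglyMeasurable.norm.pow 2)]
  congr 1
  refine lintegral_congr fun x => ?_
  rw [ENNReal.ofReal_pow (norm_nonneg _), ofReal_norm]

/-- With |v| ≥ 1 the energy estimate reads D² ≤ D W, which together with W ≤ D leaves no room for
the quartic deficit. -/
theorem SolvesProfile.ae_eq_const (h : SolvesProfile v Q) (hv : 1 ≤ |v|)
    (hQ : StronglyMeasurable Q) (hQ1 : ∀ x, ‖Q x‖ = 1) (hG : gagliardo Q ≠ ⊤) :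
    ∃ y, ∀ᵐ x : ℝ, Q x = Q y := by
  have hd := memLp_diffQuot hQ hG
  have hw := memLp_wedgeQuot hQ hQ1 hG
  have hd2 := toReal_eLpNorm_two_sq hd
  have hw2 := toReal_eLpNorm_two_sq hw
  have hdi := integrable_norm_diffQuot_sq hQ hG
  have hwi : Integrable fun z => ‖wedgeQuot Q z‖ ^ 2 :=
    (memLp_two_iff_integrable_sq_norm hQ.wedgeQuot.aestronglyMeasurable).1 hw
  have hle : ∀ z, ‖wedgeQuot Q z‖ ^ 2 ≤ ‖diffQuot Q z‖ ^ 2 := fun z =>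
    pow_le_pow_left₀ (norm_nonneg _) (norm_wedgeQuot_le hQ1 z) 2
  have hE := h.ofReal_energy_le hQ hQ1 hG
  rw [ENNReal.ofReal_le_iff_le_toReal
    (ENNReal.mul_ne_top hd.eLpNorm_ne_top hw.eLpNorm_ne_top), ENNReal.toReal_mul] at hE
  have hInt : ∫ z, (‖diffQuot Q z‖ ^ 2 - ‖wedgeQuot Q z‖ ^ 2) = 0 := by
    refine le_antisymm ?_ (integral_nonneg fun z => sub_nonneg.2 (hle z))
    rw [integral_sub hdi hwi, ← hd2, ← hw2]
    rw [← hd2] at hE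
    have hs : 0 ≤ (eLpNorm (diffQuot Q) 2 volume).toReal := ENNReal.toReal_nonneg
    have hb : 0 ≤ (eLpNorm (wedgeQuot Q) 2 volume).toReal := ENNReal.toReal_nonneg
    generalize (eLpNorm (diffQuot Q) 2 volume).toReal = s at *
    generalize (eLpNorm (wedgeQuot Q) 2 volume).toReal = b at *
    have h1 : s * s ≤ s * b := by nlinarith [sq_nonneg s]
    -- Dividing by D requires D > 0; if D = 0 the claim is immediate.
    rcases hs.eq_or_lt with h0 | h0
    · rw [← h0]
      nlinarith
    · have := le_of_mul_le_mul_left h1 h0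
      nlinarith
  rw [integral_eq_zero_iff_of_nonneg (fun z => sub_nonneg.2 (hle z)) (hdi.sub hwi)] at hInt
  have hae : ∀ᵐ z : ℝ × ℝ, Q z.2 = Q z.1 := by
    filter_upwards [hInt] with z hz
    rcases eq_or_ne z.1 z.2 with hz' | hz'
    · rw [hz']
    · have hu : |z.1 - z.2| ^ 2 ≠ 0 := pow_ne_zero 2 (abs_ne_zero.2 (sub_ne_zero.2 hz'))
      simp only [Pi.zero_apply, norm_diffQuot_sq, norm_wedgeQuot_sq,
        norm_wedge_sq (hQ1 _) (hQ1 _)] at hz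
      rw [← sub_div, _root_.div_eq_zero_iff, or_iff_left hu] at hz
      have h4 : ‖Q z.1 - Q z.2‖ ^ 4 = 0 := by linarith
      exact (sub_eq_zero.1 (norm_eq_zero.1 (pow_eq_zero_iff four_ne_zero |>.1 h4))).symm
  rw [Measure.volume_eq_prod] at hae
  -- Fubini: for almost every y, hence for some y, Q(x) = Q(y) for almost every x.
  exact (Measure.ae_ae_of_ae_prod hae).exists

/-! ### Passage between almost everywhere representatives, and constant maps -/

theorem ae_fst_snd_of_ae {P : ℝ → Prop} (hP : ∀ᵐ x, P x) :
    ∀ᵐ z : ℝ × ℝ, P z.1 ∧ P z.2 := by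
  rw [Measure.volume_eq_prod]
  exact (Measure.quasiMeasurePreserving_fst.ae hP).and (Measure.quasiMeasurePreserving_snd.ae hP)

theorem gagliardo_congr_ae {E : Type*} [NormedAddCommGroup E] {f g : ℝ → E}
    (hfg : ∀ᵐ x, f x = g x) : gagliardo f = gagliardo g := by
  refine lintegral_congr_ae ?_
  filter_upwards [ae_fst_snd_of_ae hfg] with z hz
  rw [hz.1, hz.2]

theorem SolvesProfile.congr_ae {Q' : ℝ → E3} (h : SolvesProfile v Q) (hQ : ∀ᵐ x, Q x = Q' x) :
    SolvesProfile v Q' := by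
  intro φ hφ hφc
  have h1 : wedgeAbsGrad Q' φ = wedgeAbsGrad Q φ := by
    rw [wedgeAbsGrad, wedgeAbsGrad, absGradPairing, absGradPairing]
    congr 1
    refine integral_congr_ae ?_
    filter_upwards [ae_fst_snd_of_ae hQ] with z hz
    rw [hz.1, hz.2]
  have h2 : distribDeriv Q' φ = distribDeriv Q φ := by
    rw [distribDeriv, distribDeriv]
    congr 1
    refine integral_congr_ae ?_
    filter_upwards [hQ] with x hx
    rw [hx]
  rw [h1, h2]
  exact h φ hφ hφc

/-- The estimates above assume measurability and unit length at every point; this supplies such a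
representative. -/
theorem exists_stronglyMeasurable_norm_eq_one (hQ : AEStronglyMeasurable Q)
    (hQ1 : ∀ᵐ x, ‖Q x‖ = 1) :
    ∃ Q' : ℝ → E3, StronglyMeasurable Q' ∧ (∀ x, ‖Q' x‖ = 1) ∧ ∀ᵐ x, Q x = Q' x := by
  classical
  have hm := hQ.stronglyMeasurable_mk
  -- The first basis vector is an arbitrary unit vector used on the null set where the length is
  -- wrong.
  refine ⟨fun x => if ‖hQ.mk Q x‖ = 1 then hQ.mk Q x else EuclideanSpace.single 0 1,
    StronglyMeasurable.ite (hm.norm.measurable (measurableSet_singleton (1 : ℝ))) hm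
      stronglyMeasurable_const, fun x => ?_, ?_⟩
  · by_cases hx : ‖hQ.mk Q x‖ = 1 <;> simp [hx]
  · filter_upwards [hQ.ae_eq_mk, hQ1] with x hx hx1
    rw [← hx, if_pos hx1]

theorem memHdotHalfSphere_const {p : E3} (hp : ‖p‖ = 1) (hQ : ∀ᵐ x, Q x = p) :
    MemHdotHalfSphere Q := by
  have hc : Q =ᵐ[volume] fun _ => p := hQ
  refine ⟨⟨⟨?_, ?_⟩, ?_⟩, ?_⟩
  · exact (continuous_const.locallyIntegrable (f := fun _ : ℝ => p)).congr hc.symm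
  · refine integrable_inv_one_add_sq.congr ?_
    filter_upwards [hQ] with x hx
    rw [hx, hp, one_div]
  · rw [gagliardo_congr_ae hQ]
    simp [gagliardo]
  · filter_upwards [hQ] with x hx
    rw [hx, hp]

theorem solvesProfile_const (v : ℝ) (p : E3) : SolvesProfile v fun _ => p := by
  intro φ hφ hφc
  have hd : Integrable (deriv φ) :=
    (hφ.continuous_deriv (by simp)).integrable_of_hasCompactSupport hφc.deriv
  rw [distribDeriv, integral_inner hd, integral_deriv_eq_zero_of_hasCompactSupport hφ hφc]
  simp [wedgeAbsGrad, absGradPairing]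

end Triviality

theorem theorem2 (v : ℝ) (hv : 1 ≤ |v|) (Q : ℝ → E3) :
    (MemHdotHalfSphere Q ∧ SolvesProfile v Q) ↔
      ∃ p : E3, ‖p‖ = 1 ∧ ∀ᵐ x : ℝ, Q x = p := by
  constructor
  · rintro ⟨⟨⟨⟨hloc, -⟩, hG⟩, hQ1⟩, hsol⟩
    obtain ⟨Q', hm, hu, hQQ'⟩ :=
      exists_stronglyMeasurable_norm_eq_one hloc.aestronglyMeasurable hQ1
    rw [gagliardo_congr_ae hQQ'] at hG
    obtain ⟨y, hy⟩ := (hsol.congr_ae hQQ').ae_eq_const hv hm hu hG.ne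
    refine ⟨Q' y, hu y, ?_⟩
    filter_upwards [hQQ', hy] with x h1 h2
    rw [h1, h2]
  · rintro ⟨p, hp, hQ⟩
    exact ⟨memHdotHalfSphere_const hp hQ,
      (solvesProfile_const v p).congr_ae (hQ.mono fun _ hx => hx.symm)⟩
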